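/- \textbf{Setting.} Let $\Omega\subset\mathbb R^2$ be a bounded connected open set whose boundary is a simple closed $C^1$ curve $\Gamma(s)$ of length $L$, parametrized anticlockwise by arc length. A particle moves with unit speed along straight lines inside $\Omega$ and along anticlockwise circular arcs (Larmor arcs) of fixed radius $\mu>0$ outside $\Omega$, with continuous velocity. It starts at $P_0=\Gamma(s_0)$, entering $\Omega$; it leaves $\Omega$ at $P_1=\Gamma(s_1)$, follows a Larmor arc outside $\Omega$ and re-enters $\Omega$ at $P_2=\Gamma(s_2)$, and so on. Let $\theta_i\in(0,\pi)$ be the angle at $P_i$ between the positively oriented tangent of $\Gamma$ and the velocity (all crossings are transversal), $u_i=-\cos\theta_i$, and $\ell_1=|P_0P_1|$. The inverse magnetic billiard map is $T:(s_0,u_0)\mapsto(s_2,u_2)$, with $s_0,s_2\in\mathbb R/L\mathbb Z$. For a trajectory of period $2$ (that is, $T^2z=z$ for $z=(s_0,u_0)$, so $P_4=P_0$ and $\theta_4=\theta_0$) let $S_2=DT(Tz)\,DT(z)$. The trajectory is called \emph{hyperbolic}, \emph{parabolic} or \emph{elliptic} if $|\operatorname{Tr}S_2|>2$, $=2$ or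 $<2$, respectively. Put $$\alpha=\frac{\ell_1}{\mu}>0,\qquad \beta=\cot\theta_0+\cot\theta_3,\qquad \delta=\cot\theta_1+\cot\theta_2 .$$ \textbf{Theorem.} Suppose that $\Omega$ is not strictly convex or is concave, i.e. $\Gamma$ has a point (near which it is $C^2$) of curvature $\le 0$. Consider a 2-periodic trajectory such that $\Gamma$ is of class $C^2$ near $P_0,P_1,P_2,P_3$. Then the derivatives $DT(z)$, $DT(Tz)$ exist, and the following holds. \begin{enumerate} \item[(i)] If $\beta=\delta=0$, the trajectory is parabolic, whatever $\alpha\in(0,\infty)$ is. \item[(ii)] If $\beta\le 0$ and $\delta\le 0$, not both zero, the trajectory is hyperbolic, whatever $\alpha\in(0,\infty)$ is. \item[(iii)] If $\beta>0$ and $\delta=0$, or $\beta>0$, $\delta<0$ and $\frac2\beta+\frac2\delta\le 0$, then the trajectory is parabolic if and only if $\alpha=\frac2\beta$; elliptic if and only if $\alpha\in\left(0,\frac2\beta\right)$; hyperbolic if and only if $\alpha\in\left(\frac2\beta,\infty\right)$. \item[(iv)] If $\beta>0$, $\delta<0$ and $\frac2\beta+\frac2\delta>0$, then the trajectory is parabolic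 if and only if $\alpha=\frac2\beta$ or $\alpha=\frac2\beta+\frac2\delta$; elliptic if and only if $\alpha\in\left(\frac2\beta+\frac2\delta,\frac2\beta\right)$; hyperbolic if and only if $\alpha\in\left(0,\frac2\beta+\frac2\delta\right)\cup\left(\frac2\beta,\infty\right)$. \item[(v)] If $\beta>0$ and $\delta>0$, let $m=\min\{\frac2\beta,\frac2\delta\}$ and $M=\max\{\frac2\beta,\frac2\delta\}$. If $\beta\ne\delta$, the trajectory is parabolic if and only if $\alpha\in\{m,M,m+M\}$; elliptic if and only if $\alpha\in(0,m)\cup(M,m+M)$; hyperbolic if and only if $\alpha\in(m,M)\cup(m+M,\infty)$. If $\beta=\delta$, then $m=M$ and the trajectory is parabolic if and only if $\alpha\in\{m,2m\}$; elliptic if and only if $\alpha\in(0,m)\cup(m,2m)$; hyperbolic if and only if $\alpha\in(2m,\infty)$. \end{enumerate} Statements (iii) and (iv) also hold with $\beta$ and $\delta$ interchanged. -/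

import Mathlib

open Set Filter Topology

/-- A planar table `Ω`, in the plane `ℝ² = ℂ`: a bounded connected open set whose boundary is a
simple closed `C¹` curve `Γ` of length `L`, parametrized by arc length (as an `L`-periodic map on
`ℝ`) in the anticlockwise direction, i.e. with `Ω` on its left. No convexity is required. -/
structure BilliardTable where
  Ω : Set ℂ
  isOpen : IsOpen Ω
  isConnected : IsConnected Ω
  isBounded : Bornology.IsBounded Ω
  L : ℝ
  L_pos : 0 < L
  Γ : ℝ → ℂ
  contDiff : ContDiff ℝ 1 Γ
  periodic : Function.Periodic Γ L
  injOn : InjOn Γ (Ico 0 L)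
  unit_speed : ∀ s, ‖deriv Γ s‖ = 1
  frontier_eq : frontier Ω = range Γ
  anticlockwise : ∀ s, ∀ᶠ t : ℝ in 𝓝[>] 0, Γ s + t * Complex.I * deriv Γ s ∈ Ω

namespace BilliardTable

/-- The signed curvature `det (Γ', Γ'')` of the boundary. -/
noncomputable def curvature (D : BilliardTable) (s : ℝ) : ℝ :=
  ((starRingEnd ℂ) (deriv D.Γ s) * deriv (deriv D.Γ) s).im

/-- The table is not strictly convex or is concave: its boundary contains a point of vanishing
or of negative curvature. -/
def NotStrictlyConvexOrConcave (D : BilliardTable) : Prop :=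
  ∃ s, ContDiffAt ℝ 2 D.Γ s ∧ D.curvature s ≤ 0

/-- The unit vector pointing to the left of the boundary curve that makes the angle `θ` with the
positively oriented tangent vector at `Γ(s)`. -/
noncomputable def dir (D : BilliardTable) (s θ : ℝ) : ℂ :=
  Complex.exp (θ * Complex.I) * deriv D.Γ s

/-- The point reached from `P` with initial unit velocity `v` after running through the angle `φ`
of the Larmor circle of radius `μ`, anticlockwise; the velocity there is `exp (iφ) * v`. -/
noncomputable def larmor (μ : ℝ) (P v : ℂ) (φ : ℝ) : ℂ :=
  P + μ * Complex.I * v * (1 - Complex.exp (φ * Complex.I))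

/-- One full step of an inverse magnetic billiard trajectory, all crossings of the boundary being
transversal: it enters `Ω` at `P₀ = Γ(s₀)` under the angle `θ₀`, runs through a straight chord of
length `ℓ` inside `Ω`, leaves at `P₁ = Γ(s₁)` under the angle `θ₁`, and follows an anticlockwise
Larmor arc of radius `μ` and opening angle `2χ` outside `Ω` (so that `χ` is the angle between
the velocity at `P₁` and the chord `P₁P₂`), until it enters `Ω` again at `P₂ = Γ(s₂)` under the
angle `θ₂`. All angles are measured against the positively oriented tangent vector; the velocity
points to the left of this vector (into `Ω`) at `P₀` and `P₂`, and to its right at `P₁`. -/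
structure IsStep (D : BilliardTable) (μ s₀ θ₀ ℓ s₁ θ₁ χ s₂ θ₂ : ℝ) : Prop where
  θ₀_mem : θ₀ ∈ Ioo 0 Real.pi
  θ₁_mem : θ₁ ∈ Ioo 0 Real.pi
  θ₂_mem : θ₂ ∈ Ioo 0 Real.pi
  χ_mem : χ ∈ Ioo 0 Real.pi
  ℓ_pos : 0 < ℓ
  exit_point : D.Γ s₁ = D.Γ s₀ + ℓ * D.dir s₀ θ₀
  chord_inside : ∀ t ∈ Ioo 0 ℓ, D.Γ s₀ + t * D.dir s₀ θ₀ ∈ D.Ω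
  exit_angle : D.dir s₀ θ₀ = D.dir s₁ (-θ₁)
  reentry_point : D.Γ s₂ = larmor μ (D.Γ s₁) (D.dir s₀ θ₀) (2 * χ)
  arc_outside : ∀ φ ∈ Ioo 0 (2 * χ), larmor μ (D.Γ s₁) (D.dir s₀ θ₀) φ ∉ closure D.Ω
  reentry_angle : Complex.exp ((2 * χ : ℝ) * Complex.I) * D.dir s₀ θ₀ = D.dir s₂ θ₂

/-- The graph of the inverse magnetic billiard map `T` in the coordinates `z = (s, u)`,
`u = -cos θ`; the arc length parameters are real numbers representing elements of `ℝ / Lℤ`. -/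
def MapsTo (D : BilliardTable) (μ : ℝ) (z z' : ℝ × ℝ) : Prop :=
  ∃ θ ℓ s₁ θ₁ χ θ', z.2 = -Real.cos θ ∧ z'.2 = -Real.cos θ' ∧
    D.IsStep μ z.1 θ ℓ s₁ θ₁ χ z'.1 θ'

/-- `A` is the derivative matrix `DT(z)`, where `T z = z'`: near `z` the map `T` is represented by
a function `F` with `F z = z'` (a local lift of `T` from `ℝ / Lℤ` to `ℝ`) which is differentiable
at `z` with Jacobian matrix `A`. -/
def IsDT (D : BilliardTable) (μ : ℝ) (z z' : ℝ × ℝ) (A : Matrix (Fin 2) (Fin 2) ℝ) : Prop :=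
  ∃ (F : ℝ × ℝ → ℝ × ℝ) (F' : ℝ × ℝ →L[ℝ] ℝ × ℝ),
    F z = z' ∧ (∀ᶠ w in 𝓝 z, D.MapsTo μ w (F w)) ∧ HasFDerivAt F F' z ∧
      A = !![(F' (1, 0)).1, (F' (0, 1)).1; (F' (1, 0)).2, (F' (0, 1)).2]

end BilliardTable

/-- A 2-periodic inverse magnetic billiard trajectory `P₀ → P₁ → P₂ → P₃ → P₄ = P₀` with Larmor
radius `μ`, hitting the boundary at points near which it is of class `C²`. -/
structure TwoPeriodicTrajectory (D : BilliardTable) (μ : ℝ) where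
  (s₀ s₁ s₂ s₃ : ℝ)
  (θ₀ θ₁ θ₂ θ₃ : ℝ)
  (ℓ₁ ℓ₃ : ℝ)
  (χ₀₂ χ₂₄ : ℝ)
  step₀₂ : D.IsStep μ s₀ θ₀ ℓ₁ s₁ θ₁ χ₀₂ s₂ θ₂
  step₂₄ : D.IsStep μ s₂ θ₂ ℓ₃ s₃ θ₃ χ₂₄ s₀ θ₀
  contDiffAt₀ : ContDiffAt ℝ 2 D.Γ s₀
  contDiffAt₁ : ContDiffAt ℝ 2 D.Γ s₁
  contDiffAt₂ : ContDiffAt ℝ 2 D.Γ s₂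
  contDiffAt₃ : ContDiffAt ℝ 2 D.Γ s₃

namespace TwoPeriodicTrajectory

variable {D : BilliardTable} {μ : ℝ}

noncomputable def α (τ : TwoPeriodicTrajectory D μ) : ℝ := τ.ℓ₁ / μ

noncomputable def β (τ : TwoPeriodicTrajectory D μ) : ℝ := Real.cot τ.θ₀ + Real.cot τ.θ₃

noncomputable def δ (τ : TwoPeriodicTrajectory D μ) : ℝ := Real.cot τ.θ₁ + Real.cot τ.θ₂

/-- The starting point `z = (s₀, u₀)` in phase space. -/
noncomputable def z₀ (τ : TwoPeriodicTrajectory D μ) : ℝ × ℝ := (τ.s₀, -Real.cos τ.θ₀)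

/-- Its image `T z = (s₂, u₂)`. -/
noncomputable def z₂ (τ : TwoPeriodicTrajectory D μ) : ℝ × ℝ := (τ.s₂, -Real.cos τ.θ₂)

/-- `S` is the stability matrix `S₂(z) = DT(T z) * DT(z)`. -/
def IsStabilityMatrix (τ : TwoPeriodicTrajectory D μ) (S : Matrix (Fin 2) (Fin 2) ℝ) : Prop :=
  ∃ A B, D.IsDT μ τ.z₀ τ.z₂ A ∧ D.IsDT μ τ.z₂ τ.z₀ B ∧ S = B * A

def IsHyperbolic (τ : TwoPeriodicTrajectory D μ) : Prop :=
  ∃ S, τ.IsStabilityMatrix S ∧ 2 < |S.trace|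

def IsParabolic (τ : TwoPeriodicTrajectory D μ) : Prop :=
  ∃ S, τ.IsStabilityMatrix S ∧ |S.trace| = 2

def IsElliptic (τ : TwoPeriodicTrajectory D μ) : Prop :=
  ∃ S, τ.IsStabilityMatrix S ∧ |S.trace| < 2

end TwoPeriodicTrajectory

/-!
The trace of the stability matrix is computed explicitly: for a 2-periodic trajectory
`Tr S₂ = α² β δ - 2 α (β + δ) + 2`, whatever the curvature of the boundary is. The classification
is then the discussion of the sign of `(Tr S₂)² - 4 = α (α β δ - 2 β - 2 δ) (α β - 2) (α δ - 2)`
(`TwoPeriodicTrajectory.stability_iff` and the lemmas on `stabilityDiscriminant`).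

*Geometry.* Summing the four displacements along a 2-periodic trajectory shows that `P₀P₁P₂P₃` is a
rectangle, so that both Larmor arcs are half circles and both chords have the length `ℓ₁`
(`TwoPeriodicTrajectory.rectangle`).

*Linearization.* A variation of a straight piece of the trajectory is described by the transversal
displacement `y = -sin θ ds` and the rotation `ω = dθ + κ ds` of the velocity. Along the chord
`(y, ω)` becomes `(y + ℓ ω, ω)`, and a half circle between the angles `θ₁` and `θ₂` acts on it by
`(y, ω) ↦ (-y, -ω + (cot θ₁ + cot θ₂) y / μ)` (`BilliardTable.linearization_half_circle`). At `P₀`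
and at `P₂` the passage from `(ds, du)` to `(y, ω)` is a change of basis, so the curvatures at
these points cancel in the trace of the product, and the curvatures at `P₁` and `P₃` never occur.

*Existence of the derivative.* Near a boundary point both of whose sides are controlled, the
boundary is the regular zero set of a function that is positive inside and negative outside of the
table (`BilliardTable.exists_boundary_coordinates`). The presence of points outside of `closure Ω`
is provided by the Larmor arcs, which makes the Jordan curve theorem unnecessary. As all crossings
are transversal, the implicit function theorem gives differentiable exit times, and compactness
keeps the rest of the neighbouring trajectories on the correct side (`exists_exit_time`). Applied
to the chord and to the arc, this yields a differentiable local lift of the billiard map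
(`BilliardTable.IsStep.exists_local_map`).

*Uniqueness.* The billiard map is single valued modulo the period of `Γ`, so two continuous local
lifts with the same value at a point agree near it, and the derivative matrix is unique
(`BilliardTable.IsDT.unique`). This turns the existential definitions of hyperbolic, parabolic and
elliptic trajectories into conditions on one number.
-/

/-! ### Boundary coordinates -/

theorem IsPreconnected.subset_of_disjoint_frontier {X : Type*} [TopologicalSpace X]
    {B A : Set X} (hB : IsPreconnected B) (hd : ∀ x ∈ B, x ∉ frontier A) (hne : (B ∩ A).Nonempty) :
    B ⊆ A := by
  by_contra hs
  obtain ⟨x, hx, hxA⟩ := not_subset.1 hs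
  have hu : B ⊆ interior A ∪ (closure A)ᶜ := fun y hy => by
    by_cases hc : y ∈ closure A
    · exact Or.inl (by_contra fun hi => hd y hy ⟨hc, hi⟩)
    · exact Or.inr hc
  obtain ⟨y, hy, hyA⟩ := hne
  have h1 : y ∈ interior A := (hu hy).resolve_right fun h => h (subset_closure hyA)
  have h2 : x ∈ (closure A)ᶜ := (hu hx).resolve_left fun h => hxA (interior_subset h)
  obtain ⟨w, -, hw1, hw2⟩ := hB _ _ isOpen_interior isClosed_closure.isOpen_compl hu
    ⟨y, hy, h1⟩ ⟨x, hx, h2⟩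
  exact hw2 (subset_closure (interior_subset hw1))

namespace BilliardTable

theorem exists_int_of_Γ_eq (D : BilliardTable) {a b : ℝ} (h : D.Γ a = D.Γ b) :
    ∃ k : ℤ, a = b + k * D.L := by
  have key : ∀ x, D.Γ (toIcoMod D.L_pos 0 x) = D.Γ x := fun x => by
    rw [toIcoMod, D.periodic.sub_zsmul_eq]
  have hm : ∀ x, toIcoMod D.L_pos 0 x ∈ Ico 0 D.L := fun x => by
    simpa using toIcoMod_mem_Ico D.L_pos 0 x
  have h1 : toIcoMod D.L_pos 0 a = toIcoMod D.L_pos 0 b :=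
    D.injOn (hm a) (hm b) (by rw [key, key, h])
  refine ⟨toIcoDiv D.L_pos 0 a - toIcoDiv D.L_pos 0 b, ?_⟩
  have ha := toIcoMod_add_toIcoDiv_zsmul D.L_pos 0 a
  have hb := toIcoMod_add_toIcoDiv_zsmul D.L_pos 0 b
  simp only [zsmul_eq_mul] at ha hb
  push_cast
  linarith

theorem deriv_Γ_add_int_mul (D : BilliardTable) (s : ℝ) (k : ℤ) :
    deriv D.Γ (s + k * D.L) = deriv D.Γ s := by
  have h : (fun x => D.Γ (x + k * D.L)) = D.Γ := funext fun x => D.periodic.int_mul k x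
  rw [← deriv_comp_add_const, h]

theorem hasDerivAt_Γ (D : BilliardTable) (s : ℝ) : HasDerivAt D.Γ (deriv D.Γ s) s :=
  (D.contDiff.differentiable one_ne_zero s).hasDerivAt

theorem hasStrictDerivAt_Γ (D : BilliardTable) (s : ℝ) :
    HasStrictDerivAt D.Γ (deriv D.Γ s) s :=
  D.contDiff.contDiffAt.hasStrictDerivAt one_ne_zero

theorem continuous_Γ (D : BilliardTable) : Continuous D.Γ := D.contDiff.continuous

theorem deriv_Γ_ne_zero (D : BilliardTable) (s : ℝ) : deriv D.Γ s ≠ 0 := by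
  intro h
  have := D.unit_speed s
  simp [h] at this

theorem conj_mul_deriv_Γ (D : BilliardTable) (s : ℝ) :
    (starRingEnd ℂ) (deriv D.Γ s) * deriv D.Γ s = 1 := by
  rw [mul_comm, Complex.mul_conj, Complex.normSq_eq_norm_sq, D.unit_speed]
  simp

theorem Γ_mem_frontier (D : BilliardTable) (s : ℝ) : D.Γ s ∈ frontier D.Ω := by
  rw [D.frontier_eq]; exact mem_range_self s

theorem Γ_notMem (D : BilliardTable) (s : ℝ) : D.Γ s ∉ D.Ω := by
  have := D.Γ_mem_frontier s
  rw [D.isOpen.frontier_eq] at this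
  exact this.2

theorem Γ_mem_closure (D : BilliardTable) (s : ℝ) : D.Γ s ∈ closure D.Ω :=
  frontier_subset_closure (D.Γ_mem_frontier s)

/-- Since the boundary curve is simple and closed, the part of it near `Γ(s₀)` is the image of a
neighbourhood of `s₀`: no other branch of the curve comes close. -/
theorem eventually_exists_eq_Γ (D : BilliardTable) (s₀ : ℝ) {N : Set ℝ} (hN : N ∈ 𝓝 s₀) :
    ∀ᶠ P in 𝓝 (D.Γ s₀), P ∈ frontier D.Ω → ∃ s ∈ N, D.Γ s = P := by
  obtain ⟨ε, hε, hsub⟩ := Metric.mem_nhds_iff.1 hN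
  have hK : IsCompact (D.Γ '' Icc (s₀ + ε / 2) (s₀ + D.L - ε / 2)) :=
    isCompact_Icc.image D.continuous_Γ
  have hmem : D.Γ s₀ ∉ D.Γ '' Icc (s₀ + ε / 2) (s₀ + D.L - ε / 2) := by
    rintro ⟨t, ht, he⟩
    obtain ⟨k, rfl⟩ := D.exists_int_of_Γ_eq he
    have hL := D.L_pos
    have h1 : (0 : ℝ) < k := by
      by_contra hk
      have : (k : ℝ) * D.L ≤ 0 := mul_nonpos_of_nonpos_of_nonneg (not_lt.1 hk) hL.le
      linarith [ht.1]
    have h2 : (k : ℝ) < 1 := by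
      by_contra hk
      have : 1 * D.L ≤ (k : ℝ) * D.L := mul_le_mul_of_nonneg_right (not_lt.1 hk) hL.le
      linarith [ht.2]
    have h3 : (0 : ℤ) < k := by exact_mod_cast h1
    have h4 : k < (1 : ℤ) := by exact_mod_cast h2
    omega
  filter_upwards [hK.isClosed.isOpen_compl.mem_nhds hmem] with P hP hPf
  rw [D.frontier_eq] at hPf
  obtain ⟨t, rfl⟩ := hPf
  obtain ⟨t', ht', he⟩ := D.periodic.exists_mem_Ico D.L_pos t (s₀ - ε / 2)
  refine ⟨t', hsub ?_, he.symm⟩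
  rw [Metric.mem_ball, Real.dist_eq, abs_lt]
  refine ⟨by linarith [ht'.1], ?_⟩
  by_contra hc
  exact hP ⟨t', ⟨by linarith, by linarith [ht'.2]⟩, he.symm⟩

/-- The real linear isomorphism `(a, b) ↦ (a + b i) T` for a unit vector `T`. -/
noncomputable def frameEquiv (T : ℂ) (hT : (starRingEnd ℂ) T * T = 1) : (ℝ × ℝ) ≃L[ℝ] ℂ :=
  ContinuousLinearEquiv.equivOfInverse
    ((ContinuousLinearMap.fst ℝ ℝ ℝ).smulRight T
      + (ContinuousLinearMap.snd ℝ ℝ ℝ).smulRight (Complex.I * T))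
    ((Complex.reCLM ∘L (ContinuousLinearMap.mul ℝ ℂ ((starRingEnd ℂ) T))).prod
      (Complex.imCLM ∘L (ContinuousLinearMap.mul ℝ ℂ ((starRingEnd ℂ) T))))
    (by
      rintro ⟨a, b⟩
      have : (starRingEnd ℂ) T * (a * T + b * (Complex.I * T)) = a + b * Complex.I := by
        linear_combination ((a : ℂ) + b * Complex.I) * hT
      simp [this])
    (by
      intro z
      have h : (starRingEnd ℂ) T * z = ((starRingEnd ℂ) T * z).re
        + ((starRingEnd ℂ) T * z).im * Complex.I := (Complex.re_add_im _).symm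
      simp only [add_apply, ContinuousLinearMap.smulRight_apply,
        ContinuousLinearMap.prod_apply, ContinuousLinearMap.comp_apply,
        ContinuousLinearMap.mul_apply', ContinuousLinearMap.coe_fst', ContinuousLinearMap.coe_snd',
        Complex.reCLM_apply, Complex.imCLM_apply, Complex.real_smul]
      linear_combination (-T) * h + z * hT)

theorem frameEquiv_symm_apply {T : ℂ} (hT : (starRingEnd ℂ) T * T = 1) (z : ℂ) :
    (frameEquiv T hT).symm z = (((starRingEnd ℂ) T * z).re, ((starRingEnd ℂ) T * z).im) := rfl

/-- Boundary coordinates near a point of the boundary both of whose sides are under control: an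
arc length coordinate `σ` and a function `ρ` which is positive inside and negative outside of the
table. That the right side of the curve lies outside follows without the Jordan curve theorem from
the presence of exterior points near `Γ(s₀)`, because the right side is locally connected and
misses the boundary. -/
theorem exists_boundary_coordinates (D : BilliardTable) (s₀ : ℝ)
    (hout : ∃ᶠ P in 𝓝 (D.Γ s₀), P ∉ closure D.Ω) :
    ∃ (σ ρ : ℂ → ℝ) (σ' ρ' : ℂ →L[ℝ] ℝ),
      HasStrictFDerivAt σ σ' (D.Γ s₀) ∧ HasStrictFDerivAt ρ ρ' (D.Γ s₀) ∧
      σ (D.Γ s₀) = s₀ ∧ (∀ v, ρ' v = ((starRingEnd ℂ) (deriv D.Γ s₀) * v).im) ∧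
      (∀ᶠ P in 𝓝 (D.Γ s₀), ρ P = 0 → D.Γ (σ P) = P) ∧
      (∀ᶠ P in 𝓝 (D.Γ s₀), 0 < ρ P → P ∈ D.Ω) ∧
      (∀ᶠ P in 𝓝 (D.Γ s₀), ρ P < 0 → P ∉ closure D.Ω) := by
  set T := deriv D.Γ s₀ with hTdef
  have hT : (starRingEnd ℂ) T * T = 1 := D.conj_mul_deriv_Γ s₀
  let Φ : ℝ × ℝ → ℂ := fun p => D.Γ p.1 + p.2 * (Complex.I * T)
  have hΦ0 : Φ (s₀, 0) = D.Γ s₀ := by simp [Φ]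
  have hΦs : ∀ s, Φ (s, 0) = D.Γ s := fun s => by simp [Φ]
  have hΦc : Continuous Φ := by
    have := D.continuous_Γ
    fun_prop
  have hΦ : HasStrictFDerivAt Φ (frameEquiv T hT : (ℝ × ℝ) →L[ℝ] ℂ) (s₀, 0) := by
    have h1 : HasStrictFDerivAt (fun p : ℝ × ℝ => D.Γ p.1)
        ((ContinuousLinearMap.fst ℝ ℝ ℝ).smulRight T) (s₀, 0) := by
      have := (D.hasStrictDerivAt_Γ s₀).hasStrictFDerivAt.comp (s₀, (0 : ℝ))
        (hasStrictFDerivAt_fst (𝕜 := ℝ) (E := ℝ) (F := ℝ) (p := (s₀, 0)))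
      refine this.congr_fderiv ?_
      ext <;> simp [hTdef]
    have h2 : HasStrictFDerivAt (fun p : ℝ × ℝ => (p.2 : ℂ) * (Complex.I * T))
        ((ContinuousLinearMap.snd ℝ ℝ ℝ).smulRight (Complex.I * T)) (s₀, 0) := by
      have := ((ContinuousLinearMap.snd ℝ ℝ ℝ).smulRight
        (Complex.I * T)).hasStrictFDerivAt (x := ((s₀, 0) : ℝ × ℝ))
      exact this
    exact h1.add h2
  let e := hΦ.localInverse Φ _ _
  have he : HasStrictFDerivAt e ((frameEquiv T hT).symm : ℂ →L[ℝ] ℝ × ℝ) (D.Γ s₀) := by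
    have := hΦ.to_localInverse
    rwa [hΦ0] at this
  have he0 : e (D.Γ s₀) = (s₀, 0) := by
    have := hΦ.localInverse_apply_image
    rwa [hΦ0] at this
  have hleft : ∀ᶠ p in 𝓝 (s₀, (0 : ℝ)), e (Φ p) = p := hΦ.eventually_left_inverse
  have hright : ∀ᶠ P in 𝓝 (D.Γ s₀), Φ (e P) = P := by
    have := hΦ.eventually_right_inverse
    rwa [hΦ0] at this
  -- Near the base point the boundary is the set where the second coordinate vanishes.
  have hN : {s : ℝ | e (Φ (s, 0)) = (s, 0)} ∈ 𝓝 s₀ := by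
    have hc : ContinuousAt (fun s : ℝ => (s, (0 : ℝ))) s₀ := by fun_prop
    exact hc.eventually hleft
  have hfr : ∀ᶠ P in 𝓝 (D.Γ s₀), P ∈ frontier D.Ω → (e P).2 = 0 := by
    filter_upwards [D.eventually_exists_eq_Γ s₀ hN] with P hP hPf
    obtain ⟨s, hs, rfl⟩ := hP hPf
    have hs' : e (Φ (s, 0)) = (s, 0) := hs
    rw [hΦs] at hs'
    rw [hs']
  have hbox : ∀ᶠ p in 𝓝 (s₀, (0 : ℝ)), Φ p ∈ frontier D.Ω → p.2 = 0 := by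
    have hc : Tendsto Φ (𝓝 (s₀, 0)) (𝓝 (D.Γ s₀)) := by
      have := hΦc.tendsto (s₀, 0)
      rwa [hΦ0] at this
    filter_upwards [hleft, hc.eventually hfr] with p h1 h2 h3
    rw [← h1]
    exact h2 h3
  obtain ⟨ε, hε, hball⟩ := Metric.eventually_nhds_iff_ball.1 hbox
  have hmem : ∀ a b : ℝ, a ∈ Ioo (s₀ - ε) (s₀ + ε) → b ∈ Ioo (-ε) ε →
      (a, b) ∈ Metric.ball (s₀, (0 : ℝ)) ε := by
    intro a b ha hb
    rw [← ball_prod_same]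
    refine ⟨?_, ?_⟩
    · rw [Real.ball_eq_Ioo]; exact ha
    · rw [Real.ball_eq_Ioo]; simpa using hb
  have hconn : ∀ c d : ℝ, IsPreconnected (Φ '' (Ioo (s₀ - ε) (s₀ + ε) ×ˢ Ioo c d)) := fun c d =>
    (isPreconnected_Ioo.prod isPreconnected_Ioo).image _ hΦc.continuousOn
  have hebox : ∀ᶠ P in 𝓝 (D.Γ s₀), (e P).1 ∈ Ioo (s₀ - ε) (s₀ + ε) ∧ (e P).2 ∈ Ioo (-ε) ε := by
    have hc := he.continuousAt.tendsto
    rw [he0] at hc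
    have h1 := (continuous_fst.tendsto (s₀, (0 : ℝ))).comp hc
    have h2 := (continuous_snd.tendsto (s₀, (0 : ℝ))).comp hc
    exact (h1.eventually (Ioo_mem_nhds (by linarith) (by linarith))).and
      (h2.eventually (Ioo_mem_nhds (by linarith) (by linarith)))
  have hup : Φ '' (Ioo (s₀ - ε) (s₀ + ε) ×ˢ Ioo 0 ε) ⊆ D.Ω := by
    refine (hconn 0 ε).subset_of_disjoint_frontier ?_ ?_
    · rintro _ ⟨⟨a, b⟩, ⟨ha, hb⟩, rfl⟩ hf
      exact hb.1.ne' (hball _ (hmem a b ha ⟨by linarith [hb.1], hb.2⟩) hf)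
    · obtain ⟨t, ht1, ht2⟩ := ((D.anticlockwise s₀).and (Ioo_mem_nhdsGT hε)).exists
      refine ⟨_, ⟨(s₀, t), ⟨⟨by simpa using hε, by simpa using hε⟩, ht2⟩, rfl⟩, ?_⟩
      simpa [Φ, hTdef, mul_assoc] using ht1
  have hposΩ : ∀ᶠ P in 𝓝 (D.Γ s₀), 0 < (e P).2 → P ∈ D.Ω := by
    filter_upwards [hright, hebox] with P h1 h2 h3
    rw [← h1]
    exact hup ⟨e P, ⟨h2.1, h3, h2.2.2⟩, rfl⟩
  have hdown : Φ '' (Ioo (s₀ - ε) (s₀ + ε) ×ˢ Ioo (-ε) 0) ⊆ (closure D.Ω)ᶜ := by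
    refine (hconn (-ε) 0).subset_of_disjoint_frontier ?_ ?_
    · rintro _ ⟨⟨a, b⟩, ⟨ha, hb⟩, rfl⟩ hf
      rw [frontier_compl] at hf
      exact hb.2.ne (hball _ (hmem a b ha ⟨hb.1, by linarith [hb.2]⟩)
        (frontier_closure_subset hf))
    · obtain ⟨P, hP, h1, h2, h3⟩ := (hout.and_eventually
        (hright.and (hebox.and hposΩ))).exists
      refine ⟨P, ⟨e P, ⟨h2.1, h2.2.1, ?_⟩, h1⟩, hP⟩
      by_contra hge
      rcases (not_lt.1 hge).eq_or_lt with h0 | h0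
      · apply hP
        rw [← h1, show e P = ((e P).1, 0) from Prod.ext rfl h0.symm, hΦs]
        exact D.Γ_mem_closure _
      · exact hP (subset_closure (h3 h0))
  refine ⟨fun P => (e P).1, fun P => (e P).2, _, _, he.fst, he.snd, by simp [he0], ?_, ?_,
    hposΩ, ?_⟩
  · intro v
    simp [frameEquiv_symm_apply]
  · filter_upwards [hright] with P h1 h2
    have h3 : e P = ((e P).1, 0) := Prod.ext rfl h2
    rw [h3, hΦs] at h1
    exact h1
  · filter_upwards [hright, hebox] with P h1 h2 h3
    have := hdown ⟨e P, ⟨h2.1, h2.2.1, h3⟩, rfl⟩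
    rwa [h1] at this

end BilliardTable

/-! ### Transversal exit times -/

/-- A function that is strictly differentiable with positive derivative in the last variable is
strictly increasing in this variable, uniformly in the parameter. -/
theorem HasStrictFDerivAt.eventually_lt_of_pos {E : Type*} [NormedAddCommGroup E]
    [NormedSpace ℝ E] {g : E × ℝ → ℝ} {g' : E × ℝ →L[ℝ] ℝ} {z : E} {t₀ : ℝ}
    (hg : HasStrictFDerivAt g g' (z, t₀)) (hc : 0 < g' (0, 1)) :
    ∃ ε > 0, ∀ᶠ w in 𝓝 z, ∀ t ∈ Ioo (t₀ - ε) (t₀ + ε), ∀ t' ∈ Ioo (t₀ - ε) (t₀ + ε),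
      t < t' → g (w, t) < g (w, t') := by
  -- Strict differentiability compares `g` at two nearby points with the same parameter; an error
  -- of half of the slope leaves the sign of the increment unchanged.
  have h1 := hg.isLittleO.def (half_pos hc)
  rw [Metric.eventually_nhds_iff_ball] at h1
  obtain ⟨ε, hε, h1⟩ := h1
  refine ⟨ε, hε, ?_⟩
  filter_upwards [Metric.ball_mem_nhds z hε] with w hw t ht t' ht' hlt
  have hm : ((w, t'), (w, t)) ∈ Metric.ball ((z, t₀), (z, t₀)) ε := by
    rw [← ball_prod_same, ← ball_prod_same, Real.ball_eq_Ioo]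
    exact ⟨⟨hw, ht'⟩, ⟨hw, ht⟩⟩
  have h2 := h1 _ hm
  have h3 : ((w, t') : E × ℝ) - (w, t) = (t' - t) • (0, 1) := by ext <;> simp
  simp only [h3, map_smul, smul_eq_mul, norm_smul, Real.norm_eq_abs] at h2
  have h4 : ‖((0, 1) : E × ℝ)‖ = 1 := by simp [Prod.norm_def]
  rw [h4, mul_one, _root_.abs_of_pos (sub_pos.2 hlt)] at h2
  have h5 := (abs_le.1 h2).1
  nlinarith [mul_pos (sub_pos.2 hlt) hc]

/-- A real equation `g (w, t) = 0` can be solved for `t` when `∂g/∂t ≠ 0`. -/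
theorem HasStrictFDerivAt.exists_implicit {E : Type*} [NormedAddCommGroup E]
    [NormedSpace ℝ E] [CompleteSpace E] {g : E × ℝ → ℝ} {g' : E × ℝ →L[ℝ] ℝ} {z : E} {t₀ : ℝ}
    (hg : HasStrictFDerivAt g g' (z, t₀)) (h0 : g (z, t₀) = 0) (hc : g' (0, 1) ≠ 0) :
    ∃ (τ : E → ℝ) (τ' : E →L[ℝ] ℝ), HasStrictFDerivAt τ τ' z ∧ τ z = t₀ ∧
      ∀ᶠ w in 𝓝 z, g (w, τ w) = 0 := by
  have hinv : (g' ∘L .inr ℝ E ℝ).IsInvertible := by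
    refine ⟨ContinuousLinearEquiv.unitsEquivAut ℝ (Units.mk0 _ hc), ?_⟩
    ext
    simp
  refine ⟨hg.implicitFunctionOfProdDomain hinv, _,
    hg.hasStrictFDerivAt_implicitFunctionOfProdDomain hinv, ?_, ?_⟩
  · exact (hg.eventually_apply_eq_iff_implicitFunctionOfProdDomain hinv).self_of_nhds.1 rfl
  · simpa [h0] using hg.eventually_apply_implicitFunctionOfProdDomain hinv

/-- Stability of a transversal passage. The path `γ (z, ·)` enters the set `U` through `{ρ₁ = 0}`
at time `0`, stays in `U`, and leaves it through `{ρ₂ = 0}` at time `t₁`, both crossings being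
transversal. Then the neighbouring paths `γ (w, ·)` do the same, and their exit time `τ w` is
strictly differentiable at `z`. -/
theorem exists_exit_time {E : Type*} [NormedAddCommGroup E] [NormedSpace ℝ E] [CompleteSpace E]
    {γ : E × ℝ → ℂ} {z : E} {t₁ : ℝ} {U : Set ℂ} (ht₁ : 0 < t₁) (hU : IsOpen U)
    (hγ : ∀ t, ContinuousAt γ (z, t)) (hin : ∀ t ∈ Ioo 0 t₁, γ (z, t) ∈ U)
    {ρ₁ ρ₂ : ℂ → ℝ} (h₁ : ∀ᶠ P in 𝓝 (γ (z, 0)), 0 < ρ₁ P → P ∈ U)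
    (h₂ : ∀ᶠ P in 𝓝 (γ (z, t₁)), 0 < ρ₂ P → P ∈ U)
    {g₁ g₂ : E × ℝ →L[ℝ] ℝ} (hg₁ : HasStrictFDerivAt (fun p => ρ₁ (γ p)) g₁ (z, 0))
    (hg₂ : HasStrictFDerivAt (fun p => ρ₂ (γ p)) g₂ (z, t₁))
    (hpos : 0 < g₁ (0, 1)) (hneg : g₂ (0, 1) < 0) (hstart : ∀ᶠ w in 𝓝 z, ρ₁ (γ (w, 0)) = 0)
    (hend : ρ₂ (γ (z, t₁)) = 0) :
    ∃ (τ : E → ℝ) (τ' : E →L[ℝ] ℝ), HasStrictFDerivAt τ τ' z ∧ τ z = t₁ ∧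
      ∀ᶠ w in 𝓝 z, 0 < τ w ∧ ρ₂ (γ (w, τ w)) = 0 ∧ ∀ t ∈ Ioo 0 (τ w), γ (w, t) ∈ U := by
  obtain ⟨τ, τ', hτ, hτz, hτ0⟩ := hg₂.exists_implicit hend hneg.ne
  obtain ⟨ε₁, hε₁, hmono₁⟩ := hg₁.eventually_lt_of_pos hpos
  obtain ⟨ε₂, hε₂, hmono₂⟩ := hg₂.neg.eventually_lt_of_pos (by simpa using hneg)
  have hn : ∀ {t : ℝ} {ρ : ℂ → ℝ}, (∀ᶠ P in 𝓝 (γ (z, t)), 0 < ρ P → P ∈ U) →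
      ∃ η > 0, ∀ᶠ w in 𝓝 z, ∀ s ∈ Ioo (t - η) (t + η), 0 < ρ (γ (w, s)) → γ (w, s) ∈ U := by
    intro t ρ h
    have h' := (hγ t).eventually h
    rw [Metric.eventually_nhds_iff_ball] at h'
    obtain ⟨η, hη, h'⟩ := h'
    refine ⟨η, hη, ?_⟩
    filter_upwards [Metric.ball_mem_nhds z hη] with w hw s hs
    refine h' (w, s) ?_
    rw [← ball_prod_same, Real.ball_eq_Ioo]
    exact ⟨hw, hs⟩
  obtain ⟨η₁, hη₁, hin₁⟩ := hn h₁
  obtain ⟨η₂, hη₂, hin₂⟩ := hn h₂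
  -- On `(0, a)` and on `(t₁ - b, τ w)` membership in `U` follows from the sign of `ρ₁` and `ρ₂`,
  -- and on `[a, t₁ - b]` from compactness.
  set a := min (min ε₁ η₁) t₁ / 2 with ha
  set b := min (min ε₂ η₂) t₁ / 2 with hb
  have ha0 : 0 < a := half_pos (lt_min (lt_min hε₁ hη₁) ht₁)
  have hb0 : 0 < b := half_pos (lt_min (lt_min hε₂ hη₂) ht₁)
  have ha' : min (min ε₁ η₁) t₁ = 2 * a := by rw [ha]; ring
  have hb' : min (min ε₂ η₂) t₁ = 2 * b := by rw [hb]; ring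
  have ha1 : 2 * a ≤ ε₁ := ha' ▸ (min_le_left _ _).trans (min_le_left _ _)
  have ha2 : 2 * a ≤ η₁ := ha' ▸ (min_le_left _ _).trans (min_le_right _ _)
  have hb1 : 2 * b ≤ ε₂ := hb' ▸ (min_le_left _ _).trans (min_le_left _ _)
  have hb2 : 2 * b ≤ η₂ := hb' ▸ (min_le_left _ _).trans (min_le_right _ _)
  have hb3 : 2 * b ≤ t₁ := hb' ▸ min_le_right _ _
  have hmid : ∀ᶠ w in 𝓝 z, ∀ t ∈ Icc a (t₁ - b), γ (w, t) ∈ U := by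
    refine isCompact_Icc.eventually_forall_of_forall_eventually fun t ht => ?_
    exact (hγ t).eventually (hU.mem_nhds (hin t ⟨by linarith [ht.1], by linarith [ht.2]⟩))
  have hτc : ∀ᶠ w in 𝓝 z, τ w ∈ Ioo (t₁ - b) (t₁ + b) := by
    have := hτ.continuousAt.tendsto
    rw [hτz] at this
    exact this.eventually (Ioo_mem_nhds (by linarith) (by linarith))
  refine ⟨τ, τ', hτ, hτz, ?_⟩
  filter_upwards [hτ0, hmono₁, hmono₂, hin₁, hin₂, hmid, hτc, hstart] with
    w w0 wm1 wm2 wi1 wi2 wmid wc ws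
  refine ⟨by linarith [wc.1], w0, fun t ht => ?_⟩
  rcases lt_or_ge t a with hta | hta
  · refine wi1 t ⟨by linarith [ht.1], by linarith⟩ ?_
    rw [← ws]
    exact wm1 0 ⟨by linarith, by linarith⟩ t ⟨by linarith [ht.1], by linarith⟩ ht.1
  rcases le_or_gt t (t₁ - b) with htb | htb
  · exact wmid t ⟨hta, htb⟩
  · refine wi2 t ⟨by linarith, by linarith [ht.2, wc.2]⟩ ?_
    have := wm2 t ⟨by linarith, by linarith [ht.2, wc.2]⟩ (τ w)
      ⟨by linarith [wc.1], by linarith [wc.2]⟩ ht.2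
    simp only [Pi.neg_apply, w0] at this
    linarith

/-! ### Linearization of a step -/

namespace BilliardTable

theorem norm_dir (D : BilliardTable) (s θ : ℝ) : ‖D.dir s θ‖ = 1 := by
  rw [dir, norm_mul, D.unit_speed, Complex.norm_exp_ofReal_mul_I, one_mul]

theorem dir_mul_conj (D : BilliardTable) (s θ : ℝ) :
    D.dir s θ * (starRingEnd ℂ) (D.dir s θ) = 1 := by
  rw [Complex.mul_conj, Complex.normSq_eq_norm_sq, D.norm_dir]
  simp

theorem dir_mul_conj_deriv (D : BilliardTable) (s θ : ℝ) :
    D.dir s θ * (starRingEnd ℂ) (deriv D.Γ s) = Complex.exp (θ * Complex.I) := by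
  rw [dir, mul_assoc, mul_comm (deriv D.Γ s), D.conj_mul_deriv_Γ, mul_one]

/-- The Frenet equation `Γ'' = i κ Γ'` for the unit speed curve `Γ`. -/
theorem hasStrictDerivAt_deriv_Γ (D : BilliardTable) {s : ℝ} (hs : ContDiffAt ℝ 2 D.Γ s) :
    HasStrictDerivAt (deriv D.Γ) (D.curvature s * Complex.I * deriv D.Γ s) s := by
  have h1 : ContDiffAt ℝ 1 (deriv D.Γ) s := by
    exact hs.derivWithin (by norm_num)
  have h2 := h1.hasStrictDerivAt one_ne_zero
  refine h2.congr_deriv ?_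
  have h3 : HasDerivAt (fun t => (starRingEnd ℂ) (deriv D.Γ t) * deriv D.Γ t)
      ((starRingEnd ℂ) (deriv (deriv D.Γ) s) * deriv D.Γ s
        + (starRingEnd ℂ) (deriv D.Γ s) * deriv (deriv D.Γ) s) s := by
    exact (Complex.conjCLE.hasFDerivAt.comp_hasDerivAt s h2.hasDerivAt).mul h2.hasDerivAt
  have h4 := h3.unique (by simpa only [D.conj_mul_deriv_Γ] using hasDerivAt_const s (1 : ℂ))
  set a := (starRingEnd ℂ) (deriv D.Γ s) * deriv (deriv D.Γ) s with ha
  have h5 : a.re = 0 := by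
    have h6 : (starRingEnd ℂ) a + a = 0 := by
      rw [← h4, ha, map_mul, Complex.conj_conj]; ring
    have := congrArg Complex.re h6
    simp at this
    linarith
  have h7 : ((D.curvature s : ℝ) : ℂ) * Complex.I = a := by
    apply Complex.ext <;> simp [curvature, h5, ← ha]
  rw [h7, ha]
  linear_combination (-deriv (deriv D.Γ) s) * D.conj_mul_deriv_Γ s

/-- Linearization of one step whose Larmor arc is a half circle. Here `t`, `φ` and `s₁` are the
chord length, the opening angle of the arc and the exit point along a family of trajectories with
initial data `(s, θ)`, `s₂` is the re-entry point, and minus the real part of the velocity at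
re-entry times the conjugate of `Γ'(s₂)` is the re-entry coordinate `u`. In terms of the transversal
displacement `-sin θ ds` and of the rotation `dθ + κ ds` of the velocity, the chord is a shear with
coefficient `ℓ`, and the arc is minus a shear with coefficient `-(cot θ₁ + cot θ₂) / μ`. -/
theorem linearization_half_circle (D : BilliardTable) {μ : ℝ} (hμ : 0 < μ)
    {s θ t s₁ φ s₂ : ℝ → ℝ} {ds dθ dt ds₁ dφ ds₂ θ₁ θ₂ : ℝ}
    (hs : HasDerivAt s ds 0) (hθ : HasDerivAt θ dθ 0) (ht : HasDerivAt t dt 0)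
    (hs₁ : HasDerivAt s₁ ds₁ 0) (hφ : HasDerivAt φ dφ 0) (hs₂ : HasDerivAt s₂ ds₂ 0)
    (hc₀ : ContDiffAt ℝ 2 D.Γ (s 0)) (hc₂ : ContDiffAt ℝ 2 D.Γ (s₂ 0))
    (hθ₁ : Real.sin θ₁ ≠ 0) (hθ₂ : Real.sin θ₂ ≠ 0)
    (hchord : ∀ᶠ ε in 𝓝 0, D.Γ (s₁ ε) = D.Γ (s ε) + t ε * D.dir (s ε) (θ ε))
    (harc : ∀ᶠ ε in 𝓝 0, D.Γ (s₂ ε) = larmor μ (D.Γ (s₁ ε)) (D.dir (s ε) (θ ε)) (φ ε))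
    (hexit : D.dir (s 0) (θ 0) = D.dir (s₁ 0) (-θ₁))
    (hhalf : Complex.exp (φ 0 * Complex.I) = -1)
    (hreentry : -D.dir (s 0) (θ 0) = D.dir (s₂ 0) θ₂) :
    let y := -Real.sin (θ 0) * ds + t 0 * (dθ + D.curvature (s 0) * ds)
    Real.sin θ₂ * ds₂ = y ∧
    HasDerivAt (fun ε => -(Complex.exp (φ ε * Complex.I) * D.dir (s ε) (θ ε)
        * (starRingEnd ℂ) (deriv D.Γ (s₂ ε))).re)
      (Real.sin θ₂ * (-(dθ + D.curvature (s 0) * ds)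
        + (Real.cot θ₁ + Real.cot θ₂) / μ * y - D.curvature (s₂ 0) * ds₂)) 0 := by
  intro y
  set κ₀ := D.curvature (s 0)
  set κ₂ := D.curvature (s₂ 0)
  set v := D.dir (s 0) (θ 0) with hv
  set ω := dθ + κ₀ * ds with hω
  have hvv : v * (starRingEnd ℂ) v = 1 := D.dir_mul_conj _ _
  -- the tangent vectors in the frame of the velocity
  have hT₀ : deriv D.Γ (s 0) * (starRingEnd ℂ) v = Complex.exp (-θ 0 * Complex.I) := by
    have := congrArg (starRingEnd ℂ) (D.dir_mul_conj_deriv (s 0) (θ 0))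
    rw [← Complex.exp_conj] at this
    simp only [map_mul, Complex.conj_conj, Complex.conj_ofReal, Complex.conj_I] at this
    rw [mul_comm, hv, this]
    ring_nf
  have hT₁ : deriv D.Γ (s₁ 0) * (starRingEnd ℂ) v = Complex.exp (θ₁ * Complex.I) := by
    have := congrArg (starRingEnd ℂ) (D.dir_mul_conj_deriv (s₁ 0) (-θ₁))
    rw [← Complex.exp_conj, ← hexit] at this
    simp only [map_mul, Complex.conj_conj, Complex.conj_ofReal, Complex.conj_I] at this
    rw [mul_comm, this]
    push_cast
    ring_nf
  have hT₂' : v * (starRingEnd ℂ) (deriv D.Γ (s₂ 0)) = -Complex.exp (θ₂ * Complex.I) := by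
    rw [← D.dir_mul_conj_deriv (s₂ 0) θ₂, ← hreentry]
    ring
  have hT₂ : deriv D.Γ (s₂ 0) * (starRingEnd ℂ) v = -Complex.exp (-θ₂ * Complex.I) := by
    have := congrArg (starRingEnd ℂ) hT₂'
    rw [map_neg, ← Complex.exp_conj] at this
    simp only [map_mul, Complex.conj_conj, Complex.conj_ofReal, Complex.conj_I] at this
    rw [mul_comm, this]
    ring_nf
  have hexpI : ∀ {f : ℝ → ℝ} {f' : ℝ}, HasDerivAt f f' 0 →
      HasDerivAt (fun ε => Complex.exp (f ε * Complex.I))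
        (Complex.exp (f 0 * Complex.I) * (f' * Complex.I)) 0 := fun hf =>
    (hf.ofReal_comp.mul_const Complex.I).cexp
  have hΓ : ∀ {f : ℝ → ℝ} {f' : ℝ}, HasDerivAt f f' 0 →
      HasDerivAt (fun ε => D.Γ (f ε)) (f' * deriv D.Γ (f 0)) 0 := fun {f f'} hf => by
    exact ((D.hasDerivAt_Γ (f 0)).scomp 0 hf).congr_deriv (Complex.real_smul)
  have hT : ∀ {f : ℝ → ℝ} {f' : ℝ}, HasDerivAt f f' 0 → ContDiffAt ℝ 2 D.Γ (f 0) →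
      HasDerivAt (fun ε => deriv D.Γ (f ε))
        (f' * (D.curvature (f 0) * Complex.I * deriv D.Γ (f 0))) 0 := fun {f f'} hf hc => by
    exact ((D.hasStrictDerivAt_deriv_Γ hc).hasDerivAt.scomp 0 hf).congr_deriv Complex.real_smul
  have hdir : HasDerivAt (fun ε => D.dir (s ε) (θ ε)) (ω * Complex.I * v) 0 := by
    refine ((hexpI hθ).mul (hT hs hc₀)).congr_deriv ?_
    rw [hω, hv, dir]
    push_cast
    ring
  have hv0 : D.dir (s 0) (θ 0) = v := rfl
  -- the linearized chord and the linearized arc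
  have e₁ : (ds₁ : ℂ) * deriv D.Γ (s₁ 0)
      = ds * deriv D.Γ (s 0) + (dt * v + t 0 * (ω * Complex.I * v)) :=
    (hΓ hs₁).unique (((hΓ hs).add (ht.ofReal_comp.mul hdir)).congr_of_eventuallyEq hchord)
  have e₂ : (ds₂ : ℂ) * deriv D.Γ (s₂ 0)
      = ds₁ * deriv D.Γ (s₁ 0) - μ * (2 * ω + dφ) * v := by
    refine (hΓ hs₂).unique (HasDerivAt.congr_of_eventuallyEq ?_ harc)
    refine ((hΓ hs₁).add ((hdir.const_mul (μ * Complex.I : ℂ)).mul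
      ((hexpI hφ).const_sub 1))).congr_deriv ?_
    rw [hhalf, hv0]
    linear_combination (μ * (2 * ω + dφ) * v : ℂ) * Complex.I_mul_I
  have f₁ : (ds₁ : ℂ) * Complex.exp (θ₁ * Complex.I)
      = ds * Complex.exp (-θ 0 * Complex.I) + (dt + t 0 * ω * Complex.I) := by
    linear_combination (starRingEnd ℂ v) * e₁ - ds₁ * hT₁ + ds * hT₀
      + (dt + t 0 * ω * Complex.I : ℂ) * hvv
  have f₂ : -(ds₂ : ℂ) * Complex.exp (-θ₂ * Complex.I)
      = ds₁ * Complex.exp (θ₁ * Complex.I) - μ * (2 * ω + dφ) := by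
    linear_combination (starRingEnd ℂ v) * e₂ - ds₂ * hT₂ + ds₁ * hT₁
      - (μ * (2 * ω + dφ) : ℂ) * hvv
  have hcs : ∀ x : ℝ, Complex.exp (x * Complex.I) = (⟨Real.cos x, Real.sin x⟩ : ℂ) := fun x => by
    apply Complex.ext <;> simp [Complex.exp_ofReal_mul_I_re, Complex.exp_ofReal_mul_I_im]
  have hcs' : ∀ x : ℝ, Complex.exp (-x * Complex.I) = (⟨Real.cos x, -Real.sin x⟩ : ℂ) :=
    fun x => by
      rw [← Complex.ofReal_neg, hcs, Real.cos_neg, Real.sin_neg]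
  -- The imaginary parts are transversal displacements. The real part of the second equation
  -- determines how the rotation of the velocity changes along the arc.
  rw [hcs, hcs'] at f₁
  rw [hcs, hcs'] at f₂
  have i₁ := congrArg Complex.im f₁
  have i₂ := congrArg Complex.im f₂
  have r₂ := congrArg Complex.re f₂
  simp at i₁ i₂ r₂
  have hy₁ : Real.sin θ₁ * ds₁ = y := by simp only [y]; linarith
  have hy₂ : Real.sin θ₂ * ds₂ = y := by rw [← hy₁]; linarith
  have hrot : ω + dφ = -ω + (Real.cot θ₁ + Real.cot θ₂) / μ * y := by
    have k₁ : Real.cot θ₁ * y = ds₁ * Real.cos θ₁ := by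
      rw [← hy₁, Real.cot_eq_cos_div_sin]; field_simp
    have k₂ : Real.cot θ₂ * y = ds₂ * Real.cos θ₂ := by
      rw [← hy₂, Real.cot_eq_cos_div_sin]; field_simp
    field_simp
    linarith
  refine ⟨hy₂, ?_⟩
  have hq := ((hexpI hφ).mul hdir).mul
    (Complex.conjCLE.hasFDerivAt.comp_hasDerivAt (0 : ℝ) (hT hs₂ hc₂))
  refine (Complex.reCLM.hasFDerivAt.comp_hasDerivAt (0 : ℝ) hq).neg.congr_deriv ?_
  have hz : (Complex.exp (φ 0 * Complex.I) * (dφ * Complex.I) * D.dir (s 0) (θ 0)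
        + Complex.exp (φ 0 * Complex.I) * (ω * Complex.I * v))
          * (starRingEnd ℂ) (deriv D.Γ (s₂ 0))
      + Complex.exp (φ 0 * Complex.I) * D.dir (s 0) (θ 0)
          * (starRingEnd ℂ) (ds₂ * (D.curvature (s₂ 0) * Complex.I * deriv D.Γ (s₂ 0)))
      = ((ω + dφ - κ₂ * ds₂ : ℝ) : ℂ) * Complex.I * Complex.exp (θ₂ * Complex.I) := by
    rw [hhalf, hv0]
    simp only [map_mul, Complex.conj_ofReal, Complex.conj_I]
    push_cast
    linear_combination (-(ω + dφ - κ₂ * ds₂) * Complex.I : ℂ) * hT₂'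
  have : -(((ω + dφ - κ₂ * ds₂ : ℝ) : ℂ) * Complex.I * Complex.exp (θ₂ * Complex.I)).re
      = Real.sin θ₂ * (-ω + (Real.cot θ₁ + Real.cot θ₂) / μ * y - κ₂ * ds₂) := by
    rw [← hrot, hcs]
    simp
    ring
  rw [← this, ← hz]
  simp

end BilliardTable

/-! ### Differentiability of the trajectories in their data -/

theorem HasStrictFDerivAt.apply_zero_one {E G : Type*} [NormedAddCommGroup E] [NormedSpace ℝ E]
    [NormedAddCommGroup G] [NormedSpace ℝ G] {γ : E × ℝ → G} {γ' : E × ℝ →L[ℝ] G} {z : E} {t : ℝ}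
    {d : G} (h : HasStrictFDerivAt γ γ' (z, t)) (hd : HasDerivAt (fun s => γ (z, s)) d t) :
    γ' (0, 1) = d := by
  have h1 : HasDerivAt (fun s : ℝ => ((z, s) : E × ℝ)) (0, 1) t :=
    (hasDerivAt_const t z).prodMk (hasDerivAt_id t)
  exact (h.hasFDerivAt.comp_hasDerivAt t h1).unique hd

namespace BilliardTable

section StrictDifferentiability

variable {E : Type*} [NormedAddCommGroup E] [NormedSpace ℝ E] {z : E}

theorem exists_hasStrictFDerivAt_ofReal {f : E → ℝ} {f' : E →L[ℝ] ℝ}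
    (hf : HasStrictFDerivAt f f' z) :
    ∃ g' : E →L[ℝ] ℂ, HasStrictFDerivAt (fun w => (f w : ℂ)) g' z :=
  ⟨_, Complex.ofRealCLM.hasStrictFDerivAt.comp z hf⟩

theorem exists_hasStrictFDerivAt_exp_mul_I {f : E → ℝ} {f' : E →L[ℝ] ℝ}
    (hf : HasStrictFDerivAt f f' z) :
    ∃ g' : E →L[ℝ] ℂ, HasStrictFDerivAt (fun w => Complex.exp (f w * Complex.I)) g' z := by
  obtain ⟨_, h⟩ := exists_hasStrictFDerivAt_ofReal hf
  exact ⟨_, (Complex.hasStrictFDerivAt_exp_real _).comp z (h.mul_const Complex.I)⟩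

theorem exists_hasStrictFDerivAt_Γ (D : BilliardTable) {s : E → ℝ} {s' : E →L[ℝ] ℝ}
    (hs : HasStrictFDerivAt s s' z) :
    ∃ g' : E →L[ℝ] ℂ, HasStrictFDerivAt (fun w => D.Γ (s w)) g' z :=
  ⟨_, (D.hasStrictDerivAt_Γ (s z)).hasStrictFDerivAt.comp z hs⟩

theorem exists_hasStrictFDerivAt_deriv_Γ (D : BilliardTable) {s : E → ℝ} {s' : E →L[ℝ] ℝ}
    (hs : HasStrictFDerivAt s s' z) (hc : ContDiffAt ℝ 2 D.Γ (s z)) :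
    ∃ g' : E →L[ℝ] ℂ, HasStrictFDerivAt (fun w => deriv D.Γ (s w)) g' z :=
  ⟨_, (D.hasStrictDerivAt_deriv_Γ hc).hasStrictFDerivAt.comp z hs⟩

theorem exists_hasStrictFDerivAt_larmor (μ : ℝ) {A V : E → ℂ} {A' V' : E →L[ℝ] ℂ}
    {φ : E → ℝ} {φ' : E →L[ℝ] ℝ} (hA : HasStrictFDerivAt A A' z) (hV : HasStrictFDerivAt V V' z)
    (hφ : HasStrictFDerivAt φ φ' z) :
    ∃ g' : E →L[ℝ] ℂ, HasStrictFDerivAt (fun w => larmor μ (A w) (V w) (φ w)) g' z := by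
  obtain ⟨_, h⟩ := exists_hasStrictFDerivAt_exp_mul_I hφ
  exact ⟨_, hA.add ((hV.const_mul (μ * Complex.I : ℂ)).mul (h.const_sub 1))⟩

end StrictDifferentiability

theorem hasDerivAt_larmor (μ : ℝ) (P v : ℂ) (φ : ℝ) :
    HasDerivAt (fun φ => larmor μ P v φ) (μ * (Complex.exp (φ * Complex.I) * v)) φ := by
  have h1 : HasDerivAt (fun φ : ℝ => Complex.exp (φ * Complex.I))
      (Complex.exp (φ * Complex.I) * (1 * Complex.I)) φ :=
    ((hasDerivAt_id φ).ofReal_comp.mul_const Complex.I).cexp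
  refine ((((h1.const_sub 1).const_mul (μ * Complex.I * v : ℂ))).const_add P).congr_deriv ?_
  linear_combination (-(μ * v * Complex.exp (φ * Complex.I)) : ℂ) * Complex.I_mul_I

theorem continuous_larmor (μ : ℝ) (P v : ℂ) : Continuous (larmor μ P v) := by
  unfold larmor
  fun_prop

theorem larmor_zero (μ : ℝ) (P v : ℂ) : larmor μ P v 0 = P := by simp [larmor]

/-- A unit vector is recovered from its argument relative to the tangent. -/
theorem dir_arg (D : BilliardTable) (s : ℝ) {v : ℂ} (hv : ‖v‖ = 1) :
    D.dir s (v * (starRingEnd ℂ) (deriv D.Γ s)).arg = v := by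
  have h1 : ‖v * (starRingEnd ℂ) (deriv D.Γ s)‖ = 1 := by
    rw [norm_mul, hv, Complex.norm_conj, D.unit_speed, one_mul]
  have h2 := Complex.norm_mul_exp_arg_mul_I (v * (starRingEnd ℂ) (deriv D.Γ s))
  rw [h1, Complex.ofReal_one, one_mul] at h2
  rw [dir, h2]
  linear_combination v * D.conj_mul_deriv_Γ s

theorem cos_arg_mul_conj_deriv (D : BilliardTable) (s : ℝ) {v : ℂ} (hv : ‖v‖ = 1) :
    Real.cos (v * (starRingEnd ℂ) (deriv D.Γ s)).arg
      = (v * (starRingEnd ℂ) (deriv D.Γ s)).re := by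
  have h1 : ‖v * (starRingEnd ℂ) (deriv D.Γ s)‖ = 1 := by
    rw [norm_mul, hv, Complex.norm_conj, D.unit_speed, one_mul]
  rw [Complex.cos_arg (by rw [← norm_ne_zero_iff, h1]; exact one_ne_zero), h1, div_one]

theorem im_conj_deriv_mul_dir (D : BilliardTable) (s θ : ℝ) :
    ((starRingEnd ℂ) (deriv D.Γ s) * D.dir s θ).im = Real.sin θ := by
  rw [mul_comm, D.dir_mul_conj_deriv, Complex.exp_ofReal_mul_I_im]

/-! ### Existence of the billiard map near a step -/

/-- A function that is positive inside and negative outside vanishes on the boundary. -/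
theorem eventually_eq_zero_Γ (D : BilliardTable) {s₀ : ℝ} {ρ : ℂ → ℝ}
    (hp : ∀ᶠ P in 𝓝 (D.Γ s₀), 0 < ρ P → P ∈ D.Ω)
    (hn : ∀ᶠ P in 𝓝 (D.Γ s₀), ρ P < 0 → P ∉ closure D.Ω) :
    ∀ᶠ s in 𝓝 s₀, ρ (D.Γ s) = 0 := by
  have hc := D.continuous_Γ.continuousAt (x := s₀)
  filter_upwards [hc.eventually hp, hc.eventually hn] with s h1 h2
  rcases lt_trichotomy (ρ (D.Γ s)) 0 with h | h | h
  · exact absurd (D.Γ_mem_closure s) (h2 h)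
  · exact h
  · exact absurd (h1 h) (D.Γ_notMem s)

namespace IsStep

variable {D : BilliardTable} {μ s₀ θ₀ ℓ s₁ θ₁ χ s₂ θ₂ : ℝ}

theorem frequently_notMem_closure_exit (h : D.IsStep μ s₀ θ₀ ℓ s₁ θ₁ χ s₂ θ₂) :
    ∃ᶠ P in 𝓝 (D.Γ s₁), P ∉ closure D.Ω := by
  have hc : Tendsto (larmor μ (D.Γ s₁) (D.dir s₀ θ₀)) (𝓝[>] 0) (𝓝 (D.Γ s₁)) := by
    have := (continuous_larmor μ (D.Γ s₁) (D.dir s₀ θ₀)).tendsto 0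
    rw [larmor_zero] at this
    exact this.mono_left nhdsWithin_le_nhds
  refine hc.frequently (Eventually.frequently ?_)
  filter_upwards [Ioo_mem_nhdsGT (show (0 : ℝ) < 2 * χ by linarith [h.χ_mem.1])] with φ hφ
  exact h.arc_outside φ hφ

theorem frequently_notMem_closure_reentry (h : D.IsStep μ s₀ θ₀ ℓ s₁ θ₁ χ s₂ θ₂) :
    ∃ᶠ P in 𝓝 (D.Γ s₂), P ∉ closure D.Ω := by
  have hc : Tendsto (larmor μ (D.Γ s₁) (D.dir s₀ θ₀)) (𝓝[<] (2 * χ)) (𝓝 (D.Γ s₂)) := by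
    have := (continuous_larmor μ (D.Γ s₁) (D.dir s₀ θ₀)).tendsto (2 * χ)
    rw [← h.reentry_point] at this
    exact this.mono_left nhdsWithin_le_nhds
  refine hc.frequently (Eventually.frequently ?_)
  filter_upwards [Ioo_mem_nhdsLT (show (0 : ℝ) < 2 * χ by linarith [h.χ_mem.1])] with φ hφ
  exact h.arc_outside φ hφ

/-- The inverse magnetic billiard map is defined and differentiable near the initial point of a
step, and its derivative is known if the Larmor arc is a half circle. -/
theorem exists_local_map (h : D.IsStep μ s₀ θ₀ ℓ s₁ θ₁ χ s₂ θ₂) (hμ : 0 < μ)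
    (hc₀ : ContDiffAt ℝ 2 D.Γ s₀) (hc₂ : ContDiffAt ℝ 2 D.Γ s₂)
    (hout : ∃ᶠ P in 𝓝 (D.Γ s₀), P ∉ closure D.Ω) :
    ∃ (F : ℝ × ℝ → ℝ × ℝ) (F' : ℝ × ℝ →L[ℝ] ℝ × ℝ),
      F (s₀, -Real.cos θ₀) = (s₂, -Real.cos θ₂) ∧
      (∀ᶠ w in 𝓝 (s₀, -Real.cos θ₀), D.MapsTo μ w (F w)) ∧
      HasFDerivAt F F' (s₀, -Real.cos θ₀) ∧
      (Complex.exp ((2 * χ : ℝ) * Complex.I) = -1 → ∀ x : ℝ × ℝ,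
        Real.sin θ₂ * (F' x).1 = -Real.sin θ₀ * x.1
          + ℓ * (x.2 / Real.sin θ₀ + D.curvature s₀ * x.1) ∧
        (F' x).2 = Real.sin θ₂ * (-(x.2 / Real.sin θ₀ + D.curvature s₀ * x.1)
          + (Real.cot θ₁ + Real.cot θ₂) / μ * (Real.sin θ₂ * (F' x).1)
          - D.curvature s₂ * (F' x).1)) := by
  set z : ℝ × ℝ := (s₀, -Real.cos θ₀) with hz
  have hsin₀ := Real.sin_pos_of_mem_Ioo h.θ₀_mem
  have hsin₁ := Real.sin_pos_of_mem_Ioo h.θ₁_mem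
  have hsin₂ := Real.sin_pos_of_mem_Ioo h.θ₂_mem
  obtain ⟨σ₀, ρ₀, σ₀', ρ₀', -, hρ₀, -, hρ₀', -, hp₀, hn₀⟩ := D.exists_boundary_coordinates s₀ hout
  obtain ⟨σ₁, ρ₁, σ₁', ρ₁', hσ₁, hρ₁, hσ₁z, hρ₁', hΓ₁, hp₁, hn₁⟩ :=
    D.exists_boundary_coordinates s₁ h.frequently_notMem_closure_exit
  obtain ⟨σ₂, ρ₂, σ₂', ρ₂', hσ₂, hρ₂, hσ₂z, hρ₂', hΓ₂, hp₂, hn₂⟩ :=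
    D.exists_boundary_coordinates s₂ h.frequently_notMem_closure_reentry
  have hz₀ := D.eventually_eq_zero_Γ hp₀ hn₀
  have hz₁ := D.eventually_eq_zero_Γ hp₁ hn₁
  have hz₂ := D.eventually_eq_zero_Γ hp₂ hn₂
  -- the initial angle and the initial velocity
  let Θ : ℝ × ℝ → ℝ := fun w => Real.arccos (-w.2)
  have hΘz : Θ z = θ₀ := by
    simp [Θ, hz, Real.arccos_cos h.θ₀_mem.1.le h.θ₀_mem.2.le]
  have hcos : Real.cos θ₀ ^ 2 < 1 := by nlinarith [Real.sin_sq_add_cos_sq θ₀]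
  have hΘ : HasStrictFDerivAt Θ ((1 / Real.sin θ₀) • ContinuousLinearMap.snd ℝ ℝ ℝ) z := by
    have h1 : HasStrictDerivAt Real.arccos (-(1 / √(1 - (-z.2) ^ 2))) (-z.2) := by
      refine Real.hasStrictDerivAt_arccos ?_ ?_ <;> intro hh <;> simp [hz] at hh <;>
        rw [hh] at hcos <;> norm_num at hcos
    have h2 : √(1 - (-z.2) ^ 2) = Real.sin θ₀ := by
      rw [hz, ← Real.sqrt_sq hsin₀.le, Real.sin_sq]
      simp
    rw [h2] at h1
    refine (h1.hasStrictFDerivAt.comp z (hasStrictFDerivAt_snd (𝕜 := ℝ)).neg).congr_fderiv ?_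
    ext <;> simp
  have hfst : HasStrictFDerivAt (fun w : ℝ × ℝ => w.1) (ContinuousLinearMap.fst ℝ ℝ ℝ) z :=
    hasStrictFDerivAt_fst
  let V : ℝ × ℝ → ℂ := fun w => D.dir w.1 (Θ w)
  have hVz : V z = D.dir s₀ θ₀ := by
    change D.dir s₀ (Θ z) = _
    rw [hΘz]
  obtain ⟨V', hV⟩ : ∃ V' : ℝ × ℝ →L[ℝ] ℂ, HasStrictFDerivAt V V' z := by
    obtain ⟨_, h1⟩ := exists_hasStrictFDerivAt_exp_mul_I hΘ
    obtain ⟨_, h2⟩ := D.exists_hasStrictFDerivAt_deriv_Γ hfst hc₀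
    exact ⟨_, h1.mul h2⟩
  -- the chord
  let γ₁ : (ℝ × ℝ) × ℝ → ℂ := fun p => D.Γ p.1.1 + p.2 * V p.1
  have hγ₁ : ∀ t : ℝ, ∃ γ' : (ℝ × ℝ) × ℝ →L[ℝ] ℂ, HasStrictFDerivAt γ₁ γ' (z, t) ∧
      γ' (0, 1) = D.dir s₀ θ₀ := by
    intro t
    have hf : HasStrictFDerivAt (fun p : (ℝ × ℝ) × ℝ => p.1) _ (z, t) :=
      hasStrictFDerivAt_fst (𝕜 := ℝ)
    have hs : HasStrictFDerivAt (fun p : (ℝ × ℝ) × ℝ => p.2) _ (z, t) :=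
      hasStrictFDerivAt_snd (𝕜 := ℝ)
    obtain ⟨_, h1⟩ := D.exists_hasStrictFDerivAt_Γ (HasStrictFDerivAt.comp (z, t) hfst hf)
    obtain ⟨_, h2⟩ := exists_hasStrictFDerivAt_ofReal hs
    have h3 := h1.add (h2.mul (HasStrictFDerivAt.comp (z, t) hV hf))
    refine ⟨_, h3, HasStrictFDerivAt.apply_zero_one h3 ?_⟩
    have h4 := ((hasDerivAt_id t).ofReal_comp.mul_const (V z)).const_add (D.Γ z.1)
    rw [← hVz]
    simpa using h4
  have hγ₁0 : ∀ w, γ₁ (w, 0) = D.Γ w.1 := fun w => by simp [γ₁]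
  have hγ₁ℓ : γ₁ (z, ℓ) = D.Γ s₁ := by
    change D.Γ s₀ + ℓ * V z = _
    rw [hVz, h.exit_point]
  obtain ⟨τ, τ', hτ, hτz, hchord⟩ : ∃ (τ : ℝ × ℝ → ℝ) (τ' : ℝ × ℝ →L[ℝ] ℝ),
      HasStrictFDerivAt τ τ' z ∧ τ z = ℓ ∧
      ∀ᶠ w in 𝓝 z, 0 < τ w ∧ ρ₁ (γ₁ (w, τ w)) = 0 ∧ ∀ t ∈ Ioo 0 (τ w), γ₁ (w, t) ∈ D.Ω := by
    obtain ⟨γa, ha, ha'⟩ := hγ₁ 0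
    obtain ⟨γb, hb, hb'⟩ := hγ₁ ℓ
    refine exists_exit_time h.ℓ_pos D.isOpen (fun t => (hγ₁ t).choose_spec.1.continuousAt)
      (fun t ht => ?_) (ρ₁ := ρ₀) (ρ₂ := ρ₁) (g₁ := ρ₀' ∘L γa) (g₂ := ρ₁' ∘L γb)
      ?_ ?_ ?_ ?_ ?_ ?_ ?_ ?_
    · have := h.chord_inside t ht
      rwa [← hVz] at this
    · rw [hγ₁0]; exact hp₀
    · rw [hγ₁ℓ]; exact hp₁
    · exact HasStrictFDerivAt.comp (z, (0 : ℝ)) (by rw [hγ₁0]; exact hρ₀) ha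
    · exact HasStrictFDerivAt.comp (z, ℓ) (by rw [hγ₁ℓ]; exact hρ₁) hb
    · rw [ContinuousLinearMap.comp_apply, ha', hρ₀', D.im_conj_deriv_mul_dir]
      exact hsin₀
    · rw [ContinuousLinearMap.comp_apply, hb', hρ₁', h.exit_angle, D.im_conj_deriv_mul_dir,
        Real.sin_neg]
      linarith
    · simp only [hγ₁0]
      exact hfst.continuousAt.eventually hz₀
    · rw [hγ₁ℓ]; exact hz₁.self_of_nhds
  -- the exit point
  obtain ⟨Q', hQ⟩ : ∃ Q' : ℝ × ℝ →L[ℝ] ℂ, HasStrictFDerivAt (fun w => γ₁ (w, τ w)) Q' z := by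
    obtain ⟨_, h1⟩ := D.exists_hasStrictFDerivAt_Γ hfst
    obtain ⟨_, h2⟩ := exists_hasStrictFDerivAt_ofReal hτ
    exact ⟨_, h1.add (h2.mul hV)⟩
  have hQz : γ₁ (z, τ z) = D.Γ s₁ := by rw [hτz, hγ₁ℓ]
  let S₁ : ℝ × ℝ → ℝ := fun w => σ₁ (γ₁ (w, τ w))
  have hS₁z : S₁ z = s₁ := by simp only [S₁, hQz, hσ₁z]
  have hS₁ : HasStrictFDerivAt S₁ (σ₁' ∘L Q') z :=
    HasStrictFDerivAt.comp z (by rw [hQz]; exact hσ₁) hQ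
  have hΓS₁ : ∀ᶠ w in 𝓝 z, D.Γ (S₁ w) = γ₁ (w, τ w) := by
    have hc := hQ.continuousAt.tendsto
    rw [hQz] at hc
    filter_upwards [hc.eventually hΓ₁, hchord] with w h1 h2
    exact h1 h2.2.1
  -- the Larmor arc
  let γ₂ : (ℝ × ℝ) × ℝ → ℂ := fun p => larmor μ (D.Γ (S₁ p.1)) (V p.1) p.2
  have hγ₂ : ∀ t : ℝ, ∃ γ' : (ℝ × ℝ) × ℝ →L[ℝ] ℂ, HasStrictFDerivAt γ₂ γ' (z, t) ∧
      γ' (0, 1) = μ * (Complex.exp (t * Complex.I) * D.dir s₀ θ₀) := by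
    intro t
    have hf : HasStrictFDerivAt (fun p : (ℝ × ℝ) × ℝ => p.1) _ (z, t) :=
      hasStrictFDerivAt_fst (𝕜 := ℝ)
    have hs : HasStrictFDerivAt (fun p : (ℝ × ℝ) × ℝ => p.2) _ (z, t) :=
      hasStrictFDerivAt_snd (𝕜 := ℝ)
    obtain ⟨_, h1⟩ := D.exists_hasStrictFDerivAt_Γ (HasStrictFDerivAt.comp (z, t) hS₁ hf)
    obtain ⟨_, h3⟩ := exists_hasStrictFDerivAt_larmor μ h1
      (HasStrictFDerivAt.comp (z, t) hV hf) hs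
    refine ⟨_, h3, HasStrictFDerivAt.apply_zero_one h3 ?_⟩
    rw [← hVz]
    exact hasDerivAt_larmor μ (D.Γ (S₁ z)) (V z) t
  have hγ₂z : ∀ t, γ₂ (z, t) = larmor μ (D.Γ s₁) (D.dir s₀ θ₀) t := fun t => by
    simp only [γ₂, hS₁z, hVz]
  have hγ₂0 : ∀ w, γ₂ (w, 0) = D.Γ (S₁ w) := fun w => larmor_zero _ _ _
  have hγ₂χ : γ₂ (z, 2 * χ) = D.Γ s₂ := by rw [hγ₂z, h.reentry_point]
  obtain ⟨φ, φ', hφ, hφz, harc⟩ : ∃ (φ : ℝ × ℝ → ℝ) (φ' : ℝ × ℝ →L[ℝ] ℝ),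
      HasStrictFDerivAt φ φ' z ∧ φ z = 2 * χ ∧
      ∀ᶠ w in 𝓝 z, 0 < φ w ∧ -ρ₂ (γ₂ (w, φ w)) = 0 ∧
        ∀ t ∈ Ioo 0 (φ w), γ₂ (w, t) ∈ (closure D.Ω)ᶜ := by
    obtain ⟨γa, ha, ha'⟩ := hγ₂ 0
    obtain ⟨γb, hb, hb'⟩ := hγ₂ (2 * χ)
    refine exists_exit_time (by linarith [h.χ_mem.1]) isClosed_closure.isOpen_compl
      (fun t => (hγ₂ t).choose_spec.1.continuousAt)
      (fun t ht => ?_) (ρ₁ := fun P => -ρ₁ P) (ρ₂ := fun P => -ρ₂ P)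
      (g₁ := -(ρ₁' ∘L γa)) (g₂ := -(ρ₂' ∘L γb)) ?_ ?_ ?_ ?_ ?_ ?_ ?_ ?_
    · rw [hγ₂z]; exact h.arc_outside t ht
    · rw [hγ₂0, hS₁z]
      filter_upwards [hn₁] with P hP hP'
      exact hP (by linarith)
    · rw [hγ₂χ]
      filter_upwards [hn₂] with P hP hP'
      exact hP (by linarith)
    · exact (HasStrictFDerivAt.comp (z, (0 : ℝ)) (by rw [hγ₂0, hS₁z]; exact hρ₁) ha).neg
    · exact (HasStrictFDerivAt.comp (z, 2 * χ) (by rw [hγ₂χ]; exact hρ₂) hb).neg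
    · have h1 : ((starRingEnd ℂ) (deriv D.Γ s₁) * (μ * D.dir s₁ (-θ₁))).im
          = μ * -Real.sin θ₁ := by
        rw [mul_left_comm, Complex.im_ofReal_mul, D.im_conj_deriv_mul_dir, Real.sin_neg]
      rw [neg_apply, ContinuousLinearMap.comp_apply, ha', hρ₁', h.exit_angle,
        Complex.ofReal_zero, zero_mul, Complex.exp_zero, one_mul, h1]
      nlinarith
    · have h1 : ((starRingEnd ℂ) (deriv D.Γ s₂) * (μ * D.dir s₂ θ₂)).im
          = μ * Real.sin θ₂ := by
        rw [mul_left_comm, Complex.im_ofReal_mul, D.im_conj_deriv_mul_dir]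
      rw [neg_apply, ContinuousLinearMap.comp_apply, hb', hρ₂', h.reentry_angle, h1]
      nlinarith
    · simp only [hγ₂0, neg_eq_zero]
      have := hS₁.continuousAt.tendsto
      rw [hS₁z] at this
      exact this.eventually hz₁
    · rw [hγ₂χ, hz₂.self_of_nhds, neg_zero]
  -- the re-entry point
  obtain ⟨R', hR⟩ : ∃ R' : ℝ × ℝ →L[ℝ] ℂ, HasStrictFDerivAt (fun w => γ₂ (w, φ w)) R' z := by
    obtain ⟨_, h1⟩ := D.exists_hasStrictFDerivAt_Γ hS₁
    exact exists_hasStrictFDerivAt_larmor μ h1 hV hφ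
  have hRz : γ₂ (z, φ z) = D.Γ s₂ := by rw [hφz, hγ₂χ]
  let S₂ : ℝ × ℝ → ℝ := fun w => σ₂ (γ₂ (w, φ w))
  have hS₂z : S₂ z = s₂ := by simp only [S₂, hRz, hσ₂z]
  have hS₂ : HasStrictFDerivAt S₂ (σ₂' ∘L R') z :=
    HasStrictFDerivAt.comp z (by rw [hRz]; exact hσ₂) hR
  have hΓS₂ : ∀ᶠ w in 𝓝 z, D.Γ (S₂ w) = γ₂ (w, φ w) := by
    have hc := hR.continuousAt.tendsto
    rw [hRz] at hc
    filter_upwards [hc.eventually hΓ₂, harc] with w h1 h2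
    exact h1 (neg_eq_zero.1 h2.2.1)
  -- the velocities relative to the tangent vectors at the exit and at the re-entry
  let q₁ : ℝ × ℝ → ℂ := fun w => V w * (starRingEnd ℂ) (deriv D.Γ (S₁ w))
  let q₂ : ℝ × ℝ → ℂ := fun w =>
    Complex.exp (φ w * Complex.I) * V w * (starRingEnd ℂ) (deriv D.Γ (S₂ w))
  have hVn : ∀ w, ‖V w‖ = 1 := fun w => D.norm_dir _ _
  have hV₂n : ∀ w, ‖Complex.exp (φ w * Complex.I) * V w‖ = 1 := fun w => by
    rw [norm_mul, hVn, Complex.norm_exp_ofReal_mul_I, one_mul]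
  have hq₁z : q₁ z = Complex.exp ((-θ₁ : ℝ) * Complex.I) := by
    simp only [q₁, hVz, hS₁z]
    rw [h.exit_angle, D.dir_mul_conj_deriv]
  have hq₂z : q₂ z = Complex.exp (θ₂ * Complex.I) := by
    simp only [q₂, hVz, hS₂z, hφz]
    rw [h.reentry_angle, D.dir_mul_conj_deriv]
  have hq₁c : ContinuousAt q₁ z := by
    have h1 : Continuous (deriv D.Γ) := D.contDiff.continuous_deriv le_rfl
    exact hV.continuousAt.mul (Complex.continuous_conj.continuousAt.comp
      (h1.continuousAt.comp hS₁.continuousAt))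
  obtain ⟨q₂', hq₂⟩ : ∃ q' : ℝ × ℝ →L[ℝ] ℂ, HasStrictFDerivAt q₂ q' z := by
    obtain ⟨_, h1⟩ := exists_hasStrictFDerivAt_exp_mul_I hφ
    obtain ⟨_, h2⟩ := D.exists_hasStrictFDerivAt_deriv_Γ hS₂ (by rw [hS₂z]; exact hc₂)
    exact ⟨_, (h1.mul hV).mul (Complex.conjCLE.hasStrictFDerivAt.comp z h2)⟩
  have hu : HasStrictFDerivAt (fun w => -(q₂ w).re) (-(Complex.reCLM ∘L q₂')) z :=
    (Complex.reCLM.hasStrictFDerivAt.comp z hq₂).neg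
  refine ⟨fun w => (S₂ w, -(q₂ w).re), _, ?_, ?_, (hS₂.prodMk hu).hasFDerivAt, ?_⟩
  · change (S₂ z, -(q₂ z).re) = _
    rw [hS₂z, hq₂z, Complex.exp_ofReal_mul_I_re]
  · have e₁ : ∀ᶠ w in 𝓝 z, Θ w ∈ Ioo 0 Real.pi := by
      have := hΘ.continuousAt.tendsto
      rw [hΘz] at this
      exact this.eventually (Ioo_mem_nhds h.θ₀_mem.1 h.θ₀_mem.2)
    have e₂ : ∀ᶠ w : ℝ × ℝ in 𝓝 z, w.2 ∈ Ioo (-1) 1 := by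
      refine continuous_snd.continuousAt.eventually (Ioo_mem_nhds ?_ ?_) <;> simp only [hz] <;>
        nlinarith
    have e₃ : ∀ᶠ w in 𝓝 z, (q₁ w).im < 0 := by
      have := (Complex.continuous_im.continuousAt.comp hq₁c).tendsto
      refine this.eventually (Iio_mem_nhds ?_)
      rw [Function.comp_apply, hq₁z, Complex.exp_ofReal_mul_I_im, Real.sin_neg]
      linarith
    have e₄ : ∀ᶠ w in 𝓝 z, 0 < (q₂ w).im := by
      have := (Complex.continuous_im.continuousAt.comp hq₂.continuousAt).tendsto
      refine this.eventually (Ioi_mem_nhds ?_)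
      rw [Function.comp_apply, hq₂z, Complex.exp_ofReal_mul_I_im]
      exact hsin₂
    have e₅ : ∀ᶠ w in 𝓝 z, φ w < 2 * Real.pi := by
      refine hφ.continuousAt.tendsto.eventually (Iio_mem_nhds ?_)
      rw [hφz]
      linarith [h.χ_mem.2]
    filter_upwards [e₁, e₂, e₃, e₄, e₅, hchord, harc, hΓS₁, hΓS₂] with
      w w₁ w₂ w₃ w₄ w₅ wc wa wΓ₁ wΓ₂
    have hφ2 : 2 * (φ w / 2) = φ w := by ring
    refine ⟨Θ w, τ w, S₁ w, -(q₁ w).arg, φ w / 2, (q₂ w).arg, ?_, ?_, w₁, ⟨?_, ?_⟩, ⟨?_, ?_⟩,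
      ⟨by linarith [wa.1], by linarith⟩, wc.1, wΓ₁, wc.2.2, ?_, ?_, ?_, ?_⟩
    · rw [Real.cos_arccos (by linarith [w₂.2]) (by linarith [w₂.1]), neg_neg]
    · exact congrArg Neg.neg (D.cos_arg_mul_conj_deriv (S₂ w) (hV₂n w)).symm
    · exact neg_pos.2 (Complex.arg_neg_iff.2 w₃)
    · linarith [Complex.neg_pi_lt_arg (q₁ w)]
    · refine (Complex.arg_nonneg_iff.2 w₄.le).lt_of_ne fun h0 => ?_
      exact w₄.ne' (Complex.arg_eq_zero_iff.1 h0.symm).2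
    · exact Complex.arg_lt_pi_iff.2 (Or.inr w₄.ne')
    · rw [neg_neg]
      exact (D.dir_arg (S₁ w) (hVn w)).symm
    · rw [hφ2]
      exact wΓ₂
    · rw [hφ2]
      exact wa.2.2
    · rw [hφ2]
      exact (D.dir_arg (S₂ w) (hV₂n w)).symm
  -- the derivative along the line through `z` in the direction `x`
  · intro hhalf x
    have hx : Tendsto (fun ε : ℝ => z + ε • x) (𝓝 0) (𝓝 z) := by
      have : Continuous fun ε : ℝ => z + ε • x := by fun_prop
      simpa using this.tendsto 0
    have hz0 : z + (0 : ℝ) • x = z := by simp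
    have l₁ := D.linearization_half_circle hμ (s := fun ε => (z + ε • x).1)
      (θ := fun ε => Θ (z + ε • x)) (t := fun ε => τ (z + ε • x)) (s₁ := fun ε => S₁ (z + ε • x))
      (φ := fun ε => φ (z + ε • x)) (s₂ := fun ε => S₂ (z + ε • x)) (θ₁ := θ₁) (θ₂ := θ₂)
      (hfst.hasFDerivAt.hasLineDerivAt x) (hΘ.hasFDerivAt.hasLineDerivAt x)
      (hτ.hasFDerivAt.hasLineDerivAt x) (hS₁.hasFDerivAt.hasLineDerivAt x)
      (hφ.hasFDerivAt.hasLineDerivAt x) (hS₂.hasFDerivAt.hasLineDerivAt x)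
    simp only [hz0, hΘz, hτz, hS₁z, hφz, hS₂z] at l₁
    obtain ⟨l₂, l₃⟩ := l₁ hc₀ hc₂ hsin₁.ne' hsin₂.ne' (hx.eventually hΓS₁) (hx.eventually hΓS₂)
      h.exit_angle hhalf (by rw [← h.reentry_angle, hhalf]; exact (neg_one_mul _).symm)
    have l₄ := l₃.unique (hu.hasFDerivAt.hasLineDerivAt x)
    have hΘx : ((1 / Real.sin θ₀) • ContinuousLinearMap.snd ℝ ℝ ℝ) x = x.2 / Real.sin θ₀ := by
      simp [div_eq_inv_mul]
    have hfx : ContinuousLinearMap.fst ℝ ℝ ℝ x = x.1 := rfl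
    rw [hΘx, hfx] at l₂ l₄
    refine ⟨l₂, ?_⟩
    rw [← l₂] at l₄
    exact l₄.symm

end IsStep

end BilliardTable

/-! ### Uniqueness of the billiard map and of its derivative -/

namespace BilliardTable

/-- The inverse magnetic billiard map is single valued: a chord ends, and an arc ends, where it
first meets the boundary. -/
theorem MapsTo.unique {D : BilliardTable} {μ : ℝ} {w a b : ℝ × ℝ} (ha : D.MapsTo μ w a)
    (hb : D.MapsTo μ w b) : ∃ k : ℤ, a.1 = b.1 + k * D.L ∧ a.2 = b.2 := by
  obtain ⟨θ, ℓ, s₁, θ₁, χ, θ', hw, ha₂, h⟩ := ha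
  obtain ⟨θb, ℓb, s₁b, θ₁b, χb, θb', hwb, hb₂, hB⟩ := hb
  obtain rfl : θ = θb := by
    refine Real.injOn_cos ⟨h.θ₀_mem.1.le, h.θ₀_mem.2.le⟩ ⟨hB.θ₀_mem.1.le, hB.θ₀_mem.2.le⟩ ?_
    linarith
  obtain rfl : ℓ = ℓb := by
    rcases lt_trichotomy ℓ ℓb with hlt | heq | hlt
    · refine absurd (hB.chord_inside ℓ ⟨h.ℓ_pos, hlt⟩) ?_
      rw [← h.exit_point]
      exact D.Γ_notMem s₁
    · exact heq
    · refine absurd (h.chord_inside ℓb ⟨hB.ℓ_pos, hlt⟩) ?_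
      rw [← hB.exit_point]
      exact D.Γ_notMem s₁b
  have hP₁ : D.Γ s₁ = D.Γ s₁b := by rw [h.exit_point, hB.exit_point]
  obtain rfl : χ = χb := by
    rcases lt_trichotomy χ χb with hlt | heq | hlt
    · refine absurd (D.Γ_mem_closure a.1) ?_
      rw [h.reentry_point, hP₁]
      exact hB.arc_outside (2 * χ) ⟨by linarith [h.χ_mem.1], by linarith⟩
    · exact heq
    · refine absurd (D.Γ_mem_closure b.1) ?_
      rw [hB.reentry_point, ← hP₁]
      exact h.arc_outside (2 * χb) ⟨by linarith [hB.χ_mem.1], by linarith⟩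
  obtain ⟨k, hk⟩ := D.exists_int_of_Γ_eq
    (show D.Γ a.1 = D.Γ b.1 by rw [h.reentry_point, hB.reentry_point, hP₁])
  refine ⟨k, hk, ?_⟩
  have hv : D.dir a.1 θ' = D.dir b.1 θb' := by rw [← h.reentry_angle, hB.reentry_angle]
  rw [dir, dir, hk, D.deriv_Γ_add_int_mul] at hv
  have hv' := congrArg Complex.re (mul_right_cancel₀ (D.deriv_Γ_ne_zero _) hv)
  rw [Complex.exp_ofReal_mul_I_re, Complex.exp_ofReal_mul_I_re] at hv'
  rw [ha₂, hb₂, hv']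

/-- The derivative matrix of the billiard map is unique: two continuous local lifts of the map
that agree at `z` agree near `z`. -/
theorem IsDT.unique {D : BilliardTable} {μ : ℝ} {z z' : ℝ × ℝ} {A B : Matrix (Fin 2) (Fin 2) ℝ}
    (hA : D.IsDT μ z z' A) (hB : D.IsDT μ z z' B) : A = B := by
  obtain ⟨F, F', hF, hFm, hFd, rfl⟩ := hA
  obtain ⟨G, G', hG, hGm, hGd, rfl⟩ := hB
  have hc : Tendsto (fun w => (F w).1 - (G w).1) (𝓝 z) (𝓝 0) := by
    have := (hFd.continuousAt.fst.sub hGd.continuousAt.fst).tendsto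
    have h0 : ((fun w => (F w).1) - fun w => (G w).1) z = 0 := by simp [hF, hG]
    rw [h0] at this
    exact this
  have hL := D.L_pos
  have heq : F =ᶠ[𝓝 z] G := by
    filter_upwards [hFm, hGm, hc.eventually (Ioo_mem_nhds (neg_lt_zero.2 hL) hL)] with w h1 h2 h3
    obtain ⟨k, hk, h4⟩ := h1.unique h2
    have h5 : (F w).1 - (G w).1 = k * D.L := by rw [hk]; ring
    rw [h5] at h3
    have h6 : (k : ℝ) < 1 := by
      by_contra hcon
      have := mul_le_mul_of_nonneg_right (not_lt.1 hcon) hL.le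
      linarith [h3.2]
    have h7 : (-1 : ℝ) < k := by
      by_contra hcon
      have := mul_le_mul_of_nonneg_right (not_lt.1 hcon) hL.le
      linarith [h3.1]
    have h8 : k < (1 : ℤ) := by exact_mod_cast h6
    have h9 : (-1 : ℤ) < k := by exact_mod_cast h7
    obtain rfl : k = 0 := by omega
    exact Prod.ext (by simpa using hk) h4
  rw [hFd.unique (hGd.congr_of_eventuallyEq heq)]

end BilliardTable

/-! ### The stability matrix of a 2-periodic trajectory -/

open BilliardTable

namespace TwoPeriodicTrajectory

variable {D : BilliardTable} {μ : ℝ}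

/-- The polygon `P₀P₁P₂P₃` of a 2-periodic trajectory is a rectangle: the total turning of the
two arcs is a multiple of `2π`, so the sum of the two Larmor chords vanishes, and so does the sum
`ℓ₁ + ℓ₃ e^{2iχ}` of the two straight segments. Hence both arcs are half circles. -/
theorem rectangle (τ : TwoPeriodicTrajectory D μ) :
    Complex.exp ((2 * τ.χ₀₂ : ℝ) * Complex.I) = -1 ∧
    Complex.exp ((2 * τ.χ₂₄ : ℝ) * Complex.I) = -1 ∧ τ.ℓ₃ = τ.ℓ₁ := by
  have h := τ.step₀₂
  have h' := τ.step₂₄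
  set e := Complex.exp ((2 * τ.χ₀₂ : ℝ) * Complex.I) with he
  set e' := Complex.exp ((2 * τ.χ₂₄ : ℝ) * Complex.I) with he'
  set v := D.dir τ.s₀ τ.θ₀ with hv
  have hv0 : v ≠ 0 := by
    rw [← norm_ne_zero_iff, D.norm_dir]; exact one_ne_zero
  have h1 : e * v = D.dir τ.s₂ τ.θ₂ := h.reentry_angle
  have h2 : e' * D.dir τ.s₂ τ.θ₂ = v := h'.reentry_angle
  have hee : e' * e = 1 := by
    rw [← h1] at h2
    exact mul_right_cancel₀ hv0 (by linear_combination h2)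
  have r₁ := h.reentry_point
  have r₂ := h'.reentry_point
  rw [h.exit_point, larmor, ← he] at r₁
  rw [h'.exit_point, r₁, ← h1, larmor, ← he'] at r₂
  have hsum : (τ.ℓ₁ : ℂ) + τ.ℓ₃ * e = 0 := by
    refine mul_right_cancel₀ hv0 ?_
    linear_combination -r₂ + μ * Complex.I * v * hee
  have hne : ‖e‖ = 1 := Complex.norm_exp_ofReal_mul_I _
  have hℓ : τ.ℓ₃ = τ.ℓ₁ := by
    have := congrArg norm (eq_neg_of_add_eq_zero_left hsum)
    rw [norm_neg, norm_mul, hne, mul_one, Complex.norm_real, Complex.norm_real,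
      Real.norm_of_nonneg h.ℓ_pos.le, Real.norm_of_nonneg h'.ℓ_pos.le] at this
    exact this.symm
  have he1 : e = -1 := by
    have h0 : (τ.ℓ₁ : ℂ) ≠ 0 := Complex.ofReal_ne_zero.2 h.ℓ_pos.ne'
    rw [hℓ] at hsum
    refine mul_left_cancel₀ h0 ?_
    linear_combination hsum
  refine ⟨he1, ?_, hℓ⟩
  rw [he1] at hee
  linear_combination -hee

/-- The stability matrix exists, and its trace does not depend on the curvature of the boundary:
relative to the transversal frame it is the product of two shears for the chords and two shears
for the arcs. -/
theorem exists_isStabilityMatrix (τ : TwoPeriodicTrajectory D μ) (hμ : 0 < μ) :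
    ∃ S, τ.IsStabilityMatrix S ∧
      S.trace = τ.α ^ 2 * τ.β * τ.δ - 2 * τ.α * (τ.β + τ.δ) + 2 := by
  obtain ⟨he, he', hℓ⟩ := τ.rectangle
  have h := τ.step₀₂
  have h' := τ.step₂₄
  have hs₀ := (Real.sin_pos_of_mem_Ioo h.θ₀_mem).ne'
  have hs₂ := (Real.sin_pos_of_mem_Ioo h.θ₂_mem).ne'
  obtain ⟨F, F', hF, hFm, hFd, hF'⟩ := h.exists_local_map hμ τ.contDiffAt₀ τ.contDiffAt₂
    h'.frequently_notMem_closure_reentry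
  obtain ⟨G, G', hG, hGm, hGd, hG'⟩ := h'.exists_local_map hμ τ.contDiffAt₂ τ.contDiffAt₀
    h.frequently_notMem_closure_reentry
  refine ⟨_, ⟨_, _, ⟨F, F', hF, hFm, hFd, rfl⟩, ⟨G, G', hG, hGm, hGd, rfl⟩, rfl⟩, ?_⟩
  obtain ⟨a₁, a₃⟩ := hF' he (1, 0)
  obtain ⟨a₂, a₄⟩ := hF' he (0, 1)
  obtain ⟨b₁, b₃⟩ := hG' he' (1, 0)
  obtain ⟨b₂, b₄⟩ := hG' he' (0, 1)
  rw [mul_comm, ← eq_div_iff hs₂] at a₁ a₂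
  rw [mul_comm, ← eq_div_iff hs₀] at b₁ b₂
  rw [a₁] at a₃
  rw [a₂] at a₄
  rw [b₁] at b₃
  rw [b₂] at b₄
  rw [Matrix.mul_fin_two, Matrix.trace_fin_two_of, a₁, a₂, a₃, a₄, b₁, b₂, b₃, b₄, hℓ]
  unfold α β δ
  generalize D.curvature τ.s₀ = κ₀
  generalize D.curvature τ.s₂ = κ₂
  field_simp
  ring

theorem IsStabilityMatrix.unique {τ : TwoPeriodicTrajectory D μ} {S S' : Matrix (Fin 2) (Fin 2) ℝ}
    (h : τ.IsStabilityMatrix S) (h' : τ.IsStabilityMatrix S') : S = S' := by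
  obtain ⟨A, B, hA, hB, rfl⟩ := h
  obtain ⟨A', B', hA', hB', rfl⟩ := h'
  rw [hA.unique hA', hB.unique hB']

end TwoPeriodicTrajectory

/-- For the trace `t = a² b d - 2 a (b + d) + 2` of the stability matrix this is `t² - 4`, factored
as `(t - 2) (t + 2)`. -/
noncomputable def stabilityDiscriminant (a b d : ℝ) : ℝ :=
  a * (a * b * d - 2 * b - 2 * d) * ((a * b - 2) * (a * d - 2))

theorem stabilityDiscriminant_comm (a b d : ℝ) :
    stabilityDiscriminant a b d = stabilityDiscriminant a d b := by
  unfold stabilityDiscriminant; ring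

theorem stabilityDiscriminant_eq (a : ℝ) {b d : ℝ} (hb : b ≠ 0) (hd : d ≠ 0) :
    stabilityDiscriminant a b d = a * (b * d) ^ 2
      * ((a - (2 / b + 2 / d)) * ((a - 2 / b) * (a - 2 / d))) := by
  unfold stabilityDiscriminant; field_simp; ring

theorem stabilityDiscriminant_eq_sq_sub (a b d : ℝ) : stabilityDiscriminant a b d
    = (a ^ 2 * b * d - 2 * a * (b + d) + 2) ^ 2 - 2 ^ 2 := by
  unfold stabilityDiscriminant; ring

namespace TwoPeriodicTrajectory

variable {D : BilliardTable} {μ : ℝ}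

theorem stability_iff (τ : TwoPeriodicTrajectory D μ) (hμ : 0 < μ) :
    (τ.IsParabolic ↔ stabilityDiscriminant τ.α τ.β τ.δ = 0) ∧
    (τ.IsElliptic ↔ stabilityDiscriminant τ.α τ.β τ.δ < 0) ∧
    (τ.IsHyperbolic ↔ 0 < stabilityDiscriminant τ.α τ.β τ.δ) := by
  obtain ⟨S, hS, ht⟩ := τ.exists_isStabilityMatrix hμ
  have key : ∀ p : ℝ → Prop, (∃ S', τ.IsStabilityMatrix S' ∧ p |S'.trace|) ↔ p |S.trace| :=
    fun p => ⟨fun ⟨S', hS', h⟩ => hS.unique hS' ▸ h, fun h => ⟨S, hS, h⟩⟩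
  rw [stabilityDiscriminant_eq_sq_sub, ← ht, sub_eq_zero, sub_neg, sub_pos, sq_eq_sq_iff_abs_eq_abs,
    sq_lt_sq, sq_lt_sq, abs_two]
  exact ⟨key (· = 2), key (· < 2), key (2 < ·)⟩

end TwoPeriodicTrajectory

/-! ### The sign of the stability discriminant -/

/-- Sign conditions for `N` on three regions that cover everything determine these regions. -/
theorem sign_iff_of_cover {N : ℝ} {P E H : Prop} (hP : P → N = 0) (hE : E → N < 0)
    (hH : H → 0 < N) (hcover : P ∨ E ∨ H) : (N = 0 ↔ P) ∧ (N < 0 ↔ E) ∧ (0 < N ↔ H) := by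
  grind

theorem stabilityDiscriminant_pos {a b d : ℝ} (ha : 0 < a) (hb : b ≤ 0) (hd : d ≤ 0)
    (hne : ¬(b = 0 ∧ d = 0)) : 0 < stabilityDiscriminant a b d := by
  have h1 : b + d < 0 := by grind
  have h2 : 0 < a * b * d - 2 * b - 2 * d := by
    have := mul_nonneg ha.le (mul_nonneg_of_nonpos_of_nonpos hb hd)
    linarith [mul_assoc a b d]
  have h3 : a * b - 2 < 0 := by linarith [mul_nonpos_of_nonneg_of_nonpos ha.le hb]
  have h4 : a * d - 2 < 0 := by linarith [mul_nonpos_of_nonneg_of_nonpos ha.le hd]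
  exact mul_pos (mul_pos ha h2) (mul_pos_of_neg_of_neg h3 h4)

theorem stabilityDiscriminant_single_threshold {a b d : ℝ} (ha : 0 < a)
    (h : (0 < b ∧ d = 0) ∨ (0 < b ∧ d < 0 ∧ 2 / b + 2 / d ≤ 0)) :
    (stabilityDiscriminant a b d = 0 ↔ a = 2 / b) ∧
    (stabilityDiscriminant a b d < 0 ↔ a ∈ Ioo 0 (2 / b)) ∧
    (0 < stabilityDiscriminant a b d ↔ a ∈ Ioi (2 / b)) := by
  obtain ⟨c, hc, hN⟩ : ∃ c, 0 < c ∧ stabilityDiscriminant a b d = c * (a - 2 / b) := by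
    rcases h with ⟨hb, rfl⟩ | ⟨hb, hd, h⟩
    · refine ⟨4 * a * b ^ 2, by positivity, ?_⟩
      unfold stabilityDiscriminant; field_simp; ring
    · refine ⟨a * (b * d) ^ 2 * ((a - (2 / b + 2 / d)) * (a - 2 / d)), ?_, ?_⟩
      · have h1 : 2 / d < 0 := div_neg_of_pos_of_neg two_pos hd
        have h2 : 0 < a - (2 / b + 2 / d) := by linarith
        have h3 : 0 < a - 2 / d := by linarith
        have h4 : 0 < (b * d) ^ 2 := by
          have := mul_ne_zero hb.ne' hd.ne
          positivity
        positivity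
      · rw [stabilityDiscriminant_eq a hb.ne' hd.ne]; ring
  rw [hN]
  refine sign_iff_of_cover ?_ ?_ ?_ ?_
  · intro h; rw [h, sub_self, mul_zero]
  · intro h; exact mul_neg_of_pos_of_neg hc (sub_neg.2 h.2)
  · intro h; exact mul_pos hc (sub_pos.2 h)
  · rcases lt_trichotomy a (2 / b) with h | h | h
    exacts [Or.inr (Or.inl ⟨ha, h⟩), Or.inl h, Or.inr (Or.inr h)]

theorem stabilityDiscriminant_two_thresholds {a b d : ℝ} (ha : 0 < a)
    (h : 0 < b ∧ d < 0 ∧ 0 < 2 / b + 2 / d) :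
    (stabilityDiscriminant a b d = 0 ↔ a = 2 / b ∨ a = 2 / b + 2 / d) ∧
    (stabilityDiscriminant a b d < 0 ↔ a ∈ Ioo (2 / b + 2 / d) (2 / b)) ∧
    (0 < stabilityDiscriminant a b d ↔ a ∈ Ioo 0 (2 / b + 2 / d) ∪ Ioi (2 / b)) := by
  obtain ⟨hb, hd, -⟩ := h
  have h1 : 2 / d < 0 := div_neg_of_pos_of_neg two_pos hd
  obtain ⟨c, hc, hN⟩ : ∃ c, 0 < c ∧
      stabilityDiscriminant a b d = c * ((a - (2 / b + 2 / d)) * (a - 2 / b)) := by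
    refine ⟨a * (b * d) ^ 2 * (a - 2 / d), ?_, ?_⟩
    · have h3 : 0 < a - 2 / d := by linarith
      have h4 : 0 < (b * d) ^ 2 := by
        have := mul_ne_zero hb.ne' hd.ne
        positivity
      positivity
    · rw [stabilityDiscriminant_eq a hb.ne' hd.ne]; ring
  rw [hN]
  refine sign_iff_of_cover ?_ ?_ ?_ ?_
  · rintro (h | h) <;> rw [h] <;> ring
  · intro h
    exact mul_neg_of_pos_of_neg hc (mul_neg_of_pos_of_neg (sub_pos.2 h.1) (sub_neg.2 h.2))
  · rintro (h | h)
    · exact mul_pos hc (mul_pos_of_neg_of_neg (sub_neg.2 h.2) (by linarith [h.2]))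
    · have h' : 2 / b < a := h
      exact mul_pos hc (mul_pos (by linarith) (sub_pos.2 h'))
  · simp only [mem_union, mem_Ioo, mem_Ioi]
    grind

theorem stabilityDiscriminant_three_thresholds {a b d m M : ℝ} (ha : 0 < a) (hb : 0 < b)
    (hd : 0 < d) (hm : m = min (2 / b) (2 / d)) (hM : M = max (2 / b) (2 / d)) :
    (b ≠ d →
      (stabilityDiscriminant a b d = 0 ↔ a = m ∨ a = M ∨ a = m + M) ∧
      (stabilityDiscriminant a b d < 0 ↔ a ∈ Ioo 0 m ∪ Ioo M (m + M)) ∧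
      (0 < stabilityDiscriminant a b d ↔ a ∈ Ioo m M ∪ Ioi (m + M))) ∧
    (b = d →
      m = M ∧
      (stabilityDiscriminant a b d = 0 ↔ a = m ∨ a = 2 * m) ∧
      (stabilityDiscriminant a b d < 0 ↔ a ∈ Ioo 0 m ∪ Ioo m (2 * m)) ∧
      (0 < stabilityDiscriminant a b d ↔ a ∈ Ioi (2 * m))) := by
  have hx : 0 < 2 / b := by positivity
  have hy : 0 < 2 / d := by positivity
  have hm0 : 0 < m := hm ▸ lt_min hx hy
  have hmM : m ≤ M := hm ▸ hM ▸ min_le_max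
  have hM0 : 0 < M := hm0.trans_le hmM
  obtain ⟨c, hc, hN⟩ : ∃ c, 0 < c ∧
      stabilityDiscriminant a b d = c * ((a - (m + M)) * ((a - m) * (a - M))) := by
    refine ⟨a * (b * d) ^ 2, by positivity, ?_⟩
    rw [stabilityDiscriminant_eq a hb.ne' hd.ne']
    rcases le_total (2 / b) (2 / d) with h | h
    · rw [hm, hM, min_eq_left h, max_eq_right h]
    · rw [hm, hM, min_eq_right h, max_eq_left h]; ring
  rw [hN]
  constructor
  · intro hne
    have hlt : m < M := by
      rw [hm, hM, min_lt_max]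
      intro h
      exact hne (by field_simp at h; exact h.symm)
    refine sign_iff_of_cover ?_ ?_ ?_ ?_
    · rintro (h | h | h) <;> rw [h] <;> ring
    · rintro (⟨-, h⟩ | ⟨h, h'⟩)
      · exact mul_neg_of_pos_of_neg hc (mul_neg_of_neg_of_pos (by linarith)
          (mul_pos_of_neg_of_neg (by linarith) (by linarith)))
      · exact mul_neg_of_pos_of_neg hc (mul_neg_of_neg_of_pos (by linarith)
          (mul_pos (by linarith) (by linarith)))
    · rintro (⟨h, h'⟩ | h)
      · exact mul_pos hc (mul_pos_of_neg_of_neg (by linarith)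
          (mul_neg_of_pos_of_neg (by linarith) (by linarith)))
      · have h' : m + M < a := h
        exact mul_pos hc (mul_pos (by linarith) (mul_pos (by linarith) (by linarith)))
    · simp only [mem_union, mem_Ioo, mem_Ioi]
      grind
  · rintro rfl
    obtain rfl : m = M := by rw [hm, hM, min_self, max_self]
    refine ⟨rfl, sign_iff_of_cover ?_ ?_ ?_ ?_⟩
    · rintro (h | h) <;> rw [h] <;> ring
    · rintro (⟨-, h⟩ | ⟨h, h'⟩)
      · exact mul_neg_of_pos_of_neg hc (mul_neg_of_neg_of_pos (by linarith)
          (mul_pos_of_neg_of_neg (by linarith) (by linarith)))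
      · exact mul_neg_of_pos_of_neg hc (mul_neg_of_neg_of_pos (by linarith)
          (mul_pos (by linarith) (by linarith)))
    · intro h
      have h' : 2 * m < a := h
      exact mul_pos hc (mul_pos (by linarith) (mul_pos (by linarith) (by linarith)))
    · simp only [mem_union, mem_Ioo, mem_Ioi]
      grind

theorem mainTheorem2 (D : BilliardTable) (hD : D.NotStrictlyConvexOrConcave)
    (μ : ℝ) (hμ : 0 < μ) (τ : TwoPeriodicTrajectory D μ) :
    -- both zero
    (τ.β = 0 ∧ τ.δ = 0 → τ.IsParabolic) ∧
    -- both nonpositive, not both zero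
    (τ.β ≤ 0 ∧ τ.δ ≤ 0 ∧ ¬ (τ.β = 0 ∧ τ.δ = 0) → τ.IsHyperbolic) ∧
    -- one positive, a single threshold
    ((0 < τ.β ∧ τ.δ = 0) ∨ (0 < τ.β ∧ τ.δ < 0 ∧ 2 / τ.β + 2 / τ.δ ≤ 0) →
      (τ.IsParabolic ↔ τ.α = 2 / τ.β) ∧
      (τ.IsElliptic ↔ τ.α ∈ Ioo 0 (2 / τ.β)) ∧
      (τ.IsHyperbolic ↔ τ.α ∈ Ioi (2 / τ.β))) ∧
    -- the same with β and δ switched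
    ((0 < τ.δ ∧ τ.β = 0) ∨ (0 < τ.δ ∧ τ.β < 0 ∧ 2 / τ.δ + 2 / τ.β ≤ 0) →
      (τ.IsParabolic ↔ τ.α = 2 / τ.δ) ∧
      (τ.IsElliptic ↔ τ.α ∈ Ioo 0 (2 / τ.δ)) ∧
      (τ.IsHyperbolic ↔ τ.α ∈ Ioi (2 / τ.δ))) ∧
    -- one positive, two thresholds
    (0 < τ.β ∧ τ.δ < 0 ∧ 0 < 2 / τ.β + 2 / τ.δ →
      (τ.IsParabolic ↔ τ.α = 2 / τ.β ∨ τ.α = 2 / τ.β + 2 / τ.δ) ∧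
      (τ.IsElliptic ↔ τ.α ∈ Ioo (2 / τ.β + 2 / τ.δ) (2 / τ.β)) ∧
      (τ.IsHyperbolic ↔ τ.α ∈ Ioo 0 (2 / τ.β + 2 / τ.δ) ∪ Ioi (2 / τ.β))) ∧
    -- the same with β and δ switched
    (0 < τ.δ ∧ τ.β < 0 ∧ 0 < 2 / τ.δ + 2 / τ.β →
      (τ.IsParabolic ↔ τ.α = 2 / τ.δ ∨ τ.α = 2 / τ.δ + 2 / τ.β) ∧
      (τ.IsElliptic ↔ τ.α ∈ Ioo (2 / τ.δ + 2 / τ.β) (2 / τ.δ)) ∧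
      (τ.IsHyperbolic ↔ τ.α ∈ Ioo 0 (2 / τ.δ + 2 / τ.β) ∪ Ioi (2 / τ.δ))) ∧
    -- both positive
    (0 < τ.β ∧ 0 < τ.δ → ∀ m M : ℝ,
      m = min (2 / τ.β) (2 / τ.δ) → M = max (2 / τ.β) (2 / τ.δ) →
      (τ.β ≠ τ.δ →
        (τ.IsParabolic ↔ τ.α = m ∨ τ.α = M ∨ τ.α = m + M) ∧
        (τ.IsElliptic ↔ τ.α ∈ Ioo 0 m ∪ Ioo M (m + M)) ∧
        (τ.IsHyperbolic ↔ τ.α ∈ Ioo m M ∪ Ioi (m + M))) ∧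
      (τ.β = τ.δ →
        m = M ∧
        (τ.IsParabolic ↔ τ.α = m ∨ τ.α = 2 * m) ∧
        (τ.IsElliptic ↔ τ.α ∈ Ioo 0 m ∪ Ioo m (2 * m)) ∧
        (τ.IsHyperbolic ↔ τ.α ∈ Ioi (2 * m)))) := by
  have hα : 0 < τ.α := div_pos τ.step₀₂.ℓ_pos hμ
  obtain ⟨hP, hE, hH⟩ := τ.stability_iff hμ
  rw [hP, hE, hH]
  refine ⟨?_, ?_, ?_, ?_, ?_, ?_, ?_⟩
  · rintro ⟨hβ, hδ⟩
    rw [hβ, hδ, stabilityDiscriminant]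
    ring
  · rintro ⟨hβ, hδ, hne⟩
    exact stabilityDiscriminant_pos hα hβ hδ hne
  · exact stabilityDiscriminant_single_threshold hα
  · rw [stabilityDiscriminant_comm]
    exact stabilityDiscriminant_single_threshold hα
  · exact stabilityDiscriminant_two_thresholds hα
  · rw [stabilityDiscriminant_comm]
    exact stabilityDiscriminant_two_thresholds hα
  · rintro ⟨hβ, hδ⟩ m M hm hM
    exact stabilityDiscriminant_three_thresholds hα hβ hδ hm hM
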